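/- Let $I$, $B$, $L$ (IRIs, blank nodes, literals) be pairwise disjoint infinite sets, $U = I\cup B\cup L$, and let $V$ be an infinite set of variables disjoint from $U$. An \emph{RDF graph} is a finite subset of $(I\cup B)\times I\times U$. A \emph{mapping} is a function $\mu$ from a finite set $\operatorname{dom}\mu\subseteq V$ to $U$; it is extended to constants $c\in I\cup L$ by $\mu(c)=c$. Two mappings are \emph{compatible} if they agree on the intersection of their domains. A \emph{constraint} $C$ is an expression $\mathrm{bound}(x)$, $\neg\mathrm{bound}(x)$, $x=y$, $x\neq y$ (with $x,y$ distinct variables), $x=c$ or $x\neq c$, where $x,y\in V$ and $c\in I\cup L$. One has $\mu\models\mathrm{bound}(x)$ iff $x\in\operatorname{dom}\mu$; $\mu\models\neg\mathrm{bound}(x)$ iff $x\notin\operatorname{dom}\mu$; and $\mu$ satisfies one of the other constraints iff all variables in it belong to $\operatorname{dom}\mu$ and the (non)equality holds for their values under $\mu$. \emph{AF-patterns} are built from triple patterns $(u,v,w)\in(I\cup L\cup V)\times(I\cup V)\times(I\cup L\cup V)$ by the operations $P_1\ \mathrm{AND}\ P_2$ and $P\ \mathrm{FILTER}\ C$ with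 $C$ a constraint. On an RDF graph $G$ a pattern $P$ evaluates to a set of mappings $[\![P]\!]_G$: $[\![(u,v,w)]\!]_G$ is the set of mappings $\mu$ with domain $\{u,v,w\}\cap V$ such that $(\mu(u),\mu(v),\mu(w))\in G$; $[\![P_1\ \mathrm{AND}\ P_2]\!]_G$ is the set of all $\mu_1\cup\mu_2$ with $\mu_i\in[\![P_i]\!]_G$ compatible; $[\![P\ \mathrm{FILTER}\ C]\!]_G=\{\mu\in[\![P]\!]_G : \mu\models C\}$. The pattern $P$ is \emph{satisfiable} if $[\![P]\!]_G\neq\emptyset$ for some RDF graph $G$. Suppose that IRIs, literals and variables are named by finite bit strings (distinct IRIs having distinct names, and likewise for literals and for variables), so that every AF-pattern is written as a fully parenthesised word over a fixed finite alphabet. \textbf{Theorem.} Satisfiability of AF-patterns can be checked in polynomial time: there are a Turing machine and a polynomial $q$ such that, on the word of any AF-pattern $P$, of length $n$, the machine halts after at most $q(n)$ steps and outputs whether $P$ is satisfiable. -/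

import Mathlib

namespace SPARQL

/-! ### RDF graphs

The types `I`, `B`, `L`, `V` are the sets of IRIs, blank nodes, literals and variables. -/

/-- Elements of `U`, the disjoint union of IRIs, blank nodes and literals. -/
inductive RDFTerm (I B L : Type) : Type
  | iri (i : I)
  | blank (b : B)
  | lit (l : L)

/-- A triple `(s, p, o)` over `U` is an RDF triple if `s` is an IRI or a blank node and `p` is
an IRI (and `o` is arbitrary). -/
def IsRDFTriple {I B L : Type} (t : RDFTerm I B L × RDFTerm I B L × RDFTerm I B L) : Prop :=
  ((∃ i, t.1 = .iri i) ∨ (∃ b, t.1 = .blank b)) ∧ ∃ i, t.2.1 = .iri i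

/-- An RDF graph is a finite set of RDF triples. -/
structure RDFGraph (I B L : Type) : Type where
  triples : Finset (RDFTerm I B L × RDFTerm I B L × RDFTerm I B L)
  isRDF : ∀ t ∈ triples, IsRDFTriple t

/-! ### Syntax of patterns -/

/-- Elements of `I ∪ L ∪ V`: first and third positions of triple patterns. -/
inductive PatTerm (I L V : Type) : Type
  | iri (i : I)
  | lit (l : L)
  | var (x : V)

/-- Elements of `I ∪ V`: second positions of triple patterns. -/
inductive PredTerm (I V : Type) : Type
  | iri (i : I)
  | var (x : V)

/-- A predicate-position term, seen as an element of `I ∪ L ∪ V`. -/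
def PredTerm.toPatTerm {I V : Type} (L : Type) : PredTerm I V → PatTerm I L V
  | .iri i => .iri i
  | .var x => .var x

/-- Constants: elements of `I ∪ L`. -/
inductive Const (I L : Type) : Type
  | iri (i : I)
  | lit (l : L)

/-- A constant, seen as an element of `U`. -/
def Const.toTerm {I L : Type} (B : Type) : Const I L → RDFTerm I B L
  | .iri i => .iri i
  | .lit l => .lit l

/-- The six forms of filter conditions. -/
inductive Constraint (I L V : Type) : Type
  /-- `bound(x)` -/
  | bound (x : V)
  /-- `¬ bound(x)` -/
  | notBound (x : V)
  /-- `x = y` -/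
  | eq (x y : V)
  /-- `x ≠ y`, with `x` and `y` distinct variables -/
  | neq (x y : V) (h : x ≠ y)
  /-- `x = c` -/
  | eqConst (x : V) (c : Const I L)
  /-- `x ≠ c` -/
  | neqConst (x : V) (c : Const I L)

/-- SPARQL patterns. -/
inductive Pattern (I L V : Type) : Type
  | triple (u : PatTerm I L V) (v : PredTerm I V) (w : PatTerm I L V)
  | union (P₁ P₂ : Pattern I L V)
  | and (P₁ P₂ : Pattern I L V)
  | opt (P₁ P₂ : Pattern I L V)
  | filter (P : Pattern I L V) (C : Constraint I L V)

/-- AF-patterns: the only operators used are AND and FILTER (with arbitrary constraints). -/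
def Pattern.IsAF {I L V : Type} : Pattern I L V → Prop
  | .triple _ _ _ => True
  | .union _ _ => False
  | .and P₁ P₂ => P₁.IsAF ∧ P₂.IsAF
  | .opt _ _ => False
  | .filter P _ => P.IsAF

/-- The type of AF-patterns. -/
abbrev AFPattern (I L V : Type) : Type := {P : Pattern I L V // P.IsAF}

/-! ### Semantics of patterns -/

/-- Solution mappings: functions into `U` defined on a finite set of variables
(`toFun x = none` means that `x` is not in the domain). -/
structure Mapping (I B L V : Type) : Type where
  toFun : V → Option (RDFTerm I B L)
  finite_dom : {x | toFun x ≠ none}.Finite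

namespace Mapping

variable {I B L V : Type}

/-- The domain of a mapping. -/
def dom (μ : Mapping I B L V) : Set V := {x | μ.toFun x ≠ none}

/-- Application of a mapping to an element of `I ∪ L ∪ V`; constants are mapped to themselves. -/
def app (μ : Mapping I B L V) : PatTerm I L V → Option (RDFTerm I B L)
  | .iri i => some (.iri i)
  | .lit l => some (.lit l)
  | .var x => μ.toFun x

/-- Two mappings are compatible if they agree on the intersection of their domains. -/
def Compatible (μ₁ μ₂ : Mapping I B L V) : Prop :=
  ∀ x, x ∈ μ₁.dom → x ∈ μ₂.dom → μ₁.toFun x = μ₂.toFun x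

/-- The union of two mappings (only used for compatible mappings). -/
def union (μ₁ μ₂ : Mapping I B L V) : Mapping I B L V where
  toFun x := (μ₁.toFun x).or (μ₂.toFun x)
  finite_dom := (μ₁.finite_dom.union μ₂.finite_dom).subset (by
    intro x hx
    simp only [Set.mem_ofPred_eq, Set.mem_union, ne_eq, Option.or_eq_none_iff] at hx ⊢
    tauto)

/-- Satisfaction of a constraint by a mapping. -/
def Sat (μ : Mapping I B L V) : Constraint I L V → Prop
  | .bound x => x ∈ μ.dom
  | .notBound x => x ∉ μ.dom
  | .eq x y => x ∈ μ.dom ∧ y ∈ μ.dom ∧ μ.toFun x = μ.toFun y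
  | .neq x y _ => x ∈ μ.dom ∧ y ∈ μ.dom ∧ μ.toFun x ≠ μ.toFun y
  | .eqConst x c => x ∈ μ.dom ∧ μ.toFun x = some (c.toTerm B)
  | .neqConst x c => x ∈ μ.dom ∧ μ.toFun x ≠ some (c.toTerm B)

/-- The join of two sets of mappings. -/
def join (Ω₁ Ω₂ : Set (Mapping I B L V)) : Set (Mapping I B L V) :=
  {μ | ∃ μ₁ ∈ Ω₁, ∃ μ₂ ∈ Ω₂, μ₁.Compatible μ₂ ∧ μ = μ₁.union μ₂}

/-- The difference of two sets of mappings: those mappings in the first set that are not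
compatible with any mapping in the second. -/
def diff (Ω₁ Ω₂ : Set (Mapping I B L V)) : Set (Mapping I B L V) :=
  {μ₁ | μ₁ ∈ Ω₁ ∧ ¬ ∃ μ₂ ∈ Ω₂, μ₁.Compatible μ₂}

end Mapping

/-- The variables of a triple pattern `(u, v, w)`, i.e. `{u, v, w} ∩ V`. -/
def tripleVars {I L V : Type} (u : PatTerm I L V) (v : PredTerm I V) (w : PatTerm I L V) :
    Set V :=
  {x | u = .var x ∨ v = .var x ∨ w = .var x}

/-- The set of mappings to which a pattern evaluates on a graph. -/
def Pattern.eval {I B L V : Type} (G : RDFGraph I B L) :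
    Pattern I L V → Set (Mapping I B L V)
  | .triple u v w =>
      {μ | μ.dom = tripleVars u v w ∧ ∃ a b c, μ.app u = some a ∧
        μ.app (v.toPatTerm L) = some b ∧ μ.app w = some c ∧ (a, b, c) ∈ G.triples}
  | .union P₁ P₂ => P₁.eval G ∪ P₂.eval G
  | .and P₁ P₂ => Mapping.join (P₁.eval G) (P₂.eval G)
  | .opt P₁ P₂ =>
      Mapping.join (P₁.eval G) (P₂.eval G) ∪ Mapping.diff (P₁.eval G) (P₂.eval G)
  | .filter P C => {μ | μ ∈ P.eval G ∧ μ.Sat C}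

/-- A pattern is satisfiable if it evaluates to a nonempty set of mappings on some RDF graph. -/
def Pattern.Satisfiable {I L V : Type} (B : Type) (P : Pattern I L V) : Prop :=
  ∃ G : RDFGraph I B L, (P.eval G).Nonempty

/-! ### Patterns as words

A pattern is written down as a fully parenthesised word over a finite alphabet: triple patterns as
`(u v w)`, compound patterns as `(P AND Q)`, `(P FILTER C)` and so on. Every IRI, literal and
variable is written as a symbol telling its kind, followed by its name, which is a bit string, and
an end marker. -/

/-- The input alphabet. -/
inductive Sym : Type
  | bit (b : Bool)
  | endMark
  | iri
  | lit
  | var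
  | lpar
  | rpar
  | kwUnion
  | kwAnd
  | kwOpt
  | kwFilter
  | kwBound
  | kwNotBound
  | kwEq
  | kwNeq
  deriving DecidableEq, Fintype

/-- A name followed by the end marker. -/
def nameWord (w : List Bool) : List Sym := w.map Sym.bit ++ [.endMark]

section Words

open Computability

variable {I L V : Type} (eI : Encoding I Bool) (eL : Encoding L Bool) (eV : Encoding V Bool)

/-- The word of an IRI. -/
def iriWord (i : I) : List Sym := .iri :: nameWord (eI.encode i)

/-- The word of a literal. -/
def litWord (l : L) : List Sym := .lit :: nameWord (eL.encode l)

/-- The word of a variable. -/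
def varWord (x : V) : List Sym := .var :: nameWord (eV.encode x)

/-- The word of an element of `I ∪ L ∪ V`. -/
def PatTerm.word : PatTerm I L V → List Sym
  | .iri i => iriWord eI i
  | .lit l => litWord eL l
  | .var x => varWord eV x

/-- The word of an element of `I ∪ V`. -/
def PredTerm.word : PredTerm I V → List Sym
  | .iri i => iriWord eI i
  | .var x => varWord eV x

/-- The word of a constant. -/
def Const.word : Const I L → List Sym
  | .iri i => iriWord eI i
  | .lit l => litWord eL l

/-- The word of a constraint. -/
def Constraint.word : Constraint I L V → List Sym
  | .bound x => .kwBound :: varWord eV x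
  | .notBound x => .kwNotBound :: varWord eV x
  | .eq x y => varWord eV x ++ .kwEq :: varWord eV y
  | .neq x y _ => varWord eV x ++ .kwNeq :: varWord eV y
  | .eqConst x c => varWord eV x ++ .kwEq :: c.word eI eL
  | .neqConst x c => varWord eV x ++ .kwNeq :: c.word eI eL

/-- The word of a pattern. -/
def Pattern.word : Pattern I L V → List Sym
  | .triple u v w =>
      .lpar :: (u.word eI eL eV ++ v.word eI eV ++ w.word eI eL eV ++ [.rpar])
  | .union P Q => .lpar :: (P.word ++ .kwUnion :: (Q.word ++ [.rpar]))
  | .and P Q => .lpar :: (P.word ++ .kwAnd :: (Q.word ++ [.rpar]))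
  | .opt P Q => .lpar :: (P.word ++ .kwOpt :: (Q.word ++ [.rpar]))
  | .filter P C => .lpar :: (P.word ++ .kwFilter :: (C.word eI eL eV ++ [.rpar]))

theorem nameWord_append_inj {w w' : List Bool} {r r' : List Sym}
    (h : nameWord w ++ r = nameWord w' ++ r') : w = w' ∧ r = r' := by
  induction w generalizing w' with
  | nil => cases w' <;> simp_all [nameWord]
  | cons a w ih =>
    cases w' with
    | nil => simp [nameWord] at h
    | cons a' w' =>
      simp only [nameWord, List.map_cons, List.cons_append, List.cons.injEq, Sym.bit.injEq] at h
      have := ih (w' := w') h.2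
      simp_all

theorem iriWord_append_inj {i i' : I} {r r' : List Sym}
    (h : iriWord eI i ++ r = iriWord eI i' ++ r') : i = i' ∧ r = r' := by
  have := nameWord_append_inj (List.cons.inj h).2
  exact ⟨eI.encode_injective this.1, this.2⟩

theorem litWord_append_inj {l l' : L} {r r' : List Sym}
    (h : litWord eL l ++ r = litWord eL l' ++ r') : l = l' ∧ r = r' := by
  have := nameWord_append_inj (List.cons.inj h).2
  exact ⟨eL.encode_injective this.1, this.2⟩

theorem varWord_append_inj {x x' : V} {r r' : List Sym}
    (h : varWord eV x ++ r = varWord eV x' ++ r') : x = x' ∧ r = r' := by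
  have := nameWord_append_inj (List.cons.inj h).2
  exact ⟨eV.encode_injective this.1, this.2⟩

theorem PatTerm.word_append_inj {u u' : PatTerm I L V} {r r' : List Sym}
    (h : u.word eI eL eV ++ r = u'.word eI eL eV ++ r') : u = u' ∧ r = r' := by
  cases u <;> cases u' <;> simp only [PatTerm.word] at h
  case iri.iri => simpa using iriWord_append_inj eI h
  case lit.lit => simpa using litWord_append_inj eL h
  case var.var => simpa using varWord_append_inj eV h
  all_goals simp [iriWord, litWord, varWord] at h

theorem PredTerm.word_append_inj {u u' : PredTerm I V} {r r' : List Sym}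
    (h : u.word eI eV ++ r = u'.word eI eV ++ r') : u = u' ∧ r = r' := by
  cases u <;> cases u' <;> simp only [PredTerm.word] at h
  case iri.iri => simpa using iriWord_append_inj eI h
  case var.var => simpa using varWord_append_inj eV h
  all_goals simp [iriWord, varWord] at h

theorem Const.word_append_inj {u u' : Const I L} {r r' : List Sym}
    (h : u.word eI eL ++ r = u'.word eI eL ++ r') : u = u' ∧ r = r' := by
  cases u <;> cases u' <;> simp only [Const.word] at h
  case iri.iri => simpa using iriWord_append_inj eI h
  case lit.lit => simpa using litWord_append_inj eL h
  all_goals simp [iriWord, litWord] at h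

theorem Constraint.word_append_inj {C C' : Constraint I L V} {r r' : List Sym}
    (h : C.word eI eL eV ++ r = C'.word eI eL eV ++ r') : C = C' ∧ r = r' := by
  cases C <;> cases C' <;>
    simp only [Constraint.word, List.append_assoc, List.cons_append, List.cons.injEq,
      true_and] at h
  case bound.bound => simpa using varWord_append_inj eV h
  case notBound.notBound => simpa using varWord_append_inj eV h
  case eq.eq =>
    obtain ⟨h₁, h⟩ := varWord_append_inj eV h
    simpa [h₁] using varWord_append_inj eV (List.cons.inj h).2
  case neq.neq =>
    obtain ⟨h₁, h⟩ := varWord_append_inj eV h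
    simpa [h₁] using varWord_append_inj eV (List.cons.inj h).2
  case eqConst.eqConst =>
    obtain ⟨h₁, h⟩ := varWord_append_inj eV h
    simpa [h₁] using Const.word_append_inj eI eL (List.cons.inj h).2
  case neqConst.neqConst =>
    obtain ⟨h₁, h⟩ := varWord_append_inj eV h
    simpa [h₁] using Const.word_append_inj eI eL (List.cons.inj h).2
  case eq.eqConst c =>
    obtain ⟨h₁, h⟩ := varWord_append_inj eV h
    cases c <;> simp [Const.word, iriWord, litWord, varWord] at h
  case eqConst.eq c _ _ =>
    obtain ⟨h₁, h⟩ := varWord_append_inj eV h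
    cases c <;> simp [Const.word, iriWord, litWord, varWord] at h
  case neq.neqConst c =>
    obtain ⟨h₁, h⟩ := varWord_append_inj eV h
    cases c <;> simp [Const.word, iriWord, litWord, varWord] at h
  case neqConst.neq c _ _ _ =>
    obtain ⟨h₁, h⟩ := varWord_append_inj eV h
    cases c <;> simp [Const.word, iriWord, litWord, varWord] at h
  all_goals first
    | (exfalso; simp [varWord] at h; done)
    | (obtain ⟨h₁, h⟩ := varWord_append_inj eV h; simp at h)

theorem Pattern.word_append_inj {P P' : Pattern I L V} {r r' : List Sym}
    (h : P.word eI eL eV ++ r = P'.word eI eL eV ++ r') : P = P' ∧ r = r' := by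
  have head : ∀ Q : Pattern I L V, ∃ s, Q.word eI eL eV = .lpar :: s := by
    intro Q; cases Q <;> exact ⟨_, rfl⟩
  have noTriple : ∀ (u : PatTerm I L V) (Q : Pattern I L V) (s s' : List Sym),
      u.word eI eL eV ++ s ≠ Q.word eI eL eV ++ s' := by
    intro u Q s s' h
    obtain ⟨t, ht⟩ := head Q
    rw [ht] at h
    cases u <;> simp [PatTerm.word, iriWord, litWord, varWord] at h
  induction P generalizing P' r r' with
  | triple u v w =>
    cases P' <;> simp only [Pattern.word, List.append_assoc, List.cons_append, List.cons.injEq,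
      true_and] at h
    case triple u' v' w' =>
      obtain ⟨rfl, h₁⟩ := PatTerm.word_append_inj eI eL eV h
      obtain ⟨rfl, h₂⟩ := PredTerm.word_append_inj eI eV h₁
      obtain ⟨rfl, h₃⟩ := PatTerm.word_append_inj eI eL eV h₂
      simpa using h₃
    all_goals exact absurd h (noTriple _ _ _ _)
  | filter P C ih =>
    cases P' <;> simp only [Pattern.word, List.append_assoc, List.cons_append, List.cons.injEq,
      true_and] at h
    case triple => exact absurd h.symm (noTriple _ _ _ _)
    case filter P' C' =>
      obtain ⟨rfl, h₁⟩ := ih h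
      obtain ⟨rfl, h₂⟩ := Constraint.word_append_inj eI eL eV (List.cons.inj h₁).2
      simpa using h₂
    all_goals exact absurd (ih h).2 (by simp)
  | union P Q ih₁ ih₂ | and P Q ih₁ ih₂ | opt P Q ih₁ ih₂ =>
    cases P' <;> simp only [Pattern.word, List.append_assoc, List.cons_append, List.cons.injEq,
      true_and] at h
    case triple => exact absurd h.symm (noTriple _ _ _ _)
    all_goals
      obtain ⟨rfl, h₁⟩ := ih₁ h
      first
      | (exfalso; simp at h₁; done)
      | (obtain ⟨rfl, h₂⟩ := ih₂ (List.cons.inj h₁).2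
         simpa using h₂)

theorem Pattern.word_injective :
    Function.Injective (Pattern.word eI eL eV : Pattern I L V → List Sym) := by
  intro P Q h
  exact (Pattern.word_append_inj eI eL eV (r := []) (r' := []) (by rw [h])).1

/-- The encoding of AF-patterns as words over the finite alphabet `Sym`, given encodings of the
IRIs, the literals and the variables as bit strings. -/
noncomputable def afEncoding : Encoding (AFPattern I L V) Sym where
  encode P := P.1.word eI eL eV
  decode := Function.partialInv fun P : AFPattern I L V => P.1.word eI eL eV
  decode_encode := Function.partialInv_left
    ((Pattern.word_injective eI eL eV).comp Subtype.val_injective)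

end Words

/-- A property `p` of objects, written down as words by means of an encoding, can be checked in
polynomial time: some Turing machine, started on the word of any object `a`, halts after a number
of steps that is at most polynomial in the length of this word, with output `true` if `p a` holds
and `false` otherwise. -/
def CheckableInPolyTime {α Γ : Type} (e : Computability.Encoding α Γ) (p : α → Prop) : Prop :=
  open Classical in
  Nonempty (Turing.TM2ComputableInPolyTime e.encode Computability.encodingBoolBool.encode
    fun a => decide (p a))

end SPARQL

/-!
An AF-pattern asks for one mapping that sends all its triple patterns into the graph at once and
satisfies all its filter constraints, where the domain of the mapping at a filter consists of the
variables in the triple patterns below this filter. Therefore the constraints can be checked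
separately from the graph. Call two terms linked if some constraint requires them to be equal, and
call the classes of the equivalence relation generated by links the classes of terms. Necessary
conditions for satisfiability are

* no class contains both sides of an inequality constraint, or two distinct constants, or both a
  literal and a subject or predicate of a triple pattern;
* a variable that is required to be bound (by `bound(x)` or by a comparison) occurs in a triple
  pattern in the scope of the filter, and a variable that is required not to be bound does not.

They are also sufficient. Send each class to the constant in it, or to a fresh IRI of its own if
there is none. The images of the triple patterns then form an RDF graph on which the pattern has a
solution; this needs infinitely many IRIs. See `Pattern.respects_of_mem_eval`,
`Pattern.solution_mem_eval` and `Pattern.satisfiable_iff`.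

The conditions are tested for the class and the scopes of one term at a time. The word of the
pattern is regarded as a list of tokens, which consist of a symbol and possibly a name, and the
symbols carry marks. The class of a term is found by marking this term and then adding, as often as there are
tokens, all terms that are linked to a marked term (`Pattern.classOf_atom`). All steps of this
procedure (`testPattern`) are of four kinds: a pass of a finite transducer over the heads of the
tokens, a comparison of all names with the name of one marked token, a run of a pushdown automaton
(for the scopes), and the repetition of a procedure as often as there are tokens. The operations on
tapes that can be carried out in polynomial time (`PolyTime`) contain the first three and are closed
under the last one and under composition, because none of them changes the length of the tape.
Programs with sequences and loops (`StackProg`) are translated to the multi-stack machines of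
Mathlib in `StackProg.Exec.iterate_step`.
-/

namespace SPARQL

open Turing

/-! ### Structured programs for stack machines -/

section StackPrograms

variable {K : Type} {Γ : K → Type} {σ : Type}

/-- Renaming of the labels of a statement. -/
def relabel {Λ Λ' : Type} (f : Λ → Λ') : TM2.Stmt Γ Λ σ → TM2.Stmt Γ Λ' σ
  | .push k g q => .push k g (relabel f q)
  | .peek k g q => .peek k g (relabel f q)
  | .pop k g q => .pop k g (relabel f q)
  | .load g q => .load g (relabel f q)
  | .branch g q₁ q₂ => .branch g (relabel f q₁) (relabel f q₂)
  | .goto l => .goto fun v => f (l v)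
  | .halt => .halt

/-- Structured programs. A basic block is a statement of the stack machine model with a single
label, which stands for the end of the block. In `loop q p` the statement `q` is executed first;
if it jumps to `true` then `p` is run and the loop starts again, and if it jumps to `false` then
the loop ends. -/
inductive StackProg (Γ : K → Type) (σ : Type) : Type
  | block (q : TM2.Stmt Γ Unit σ)
  | seq (p₁ p₂ : StackProg Γ σ)
  | loop (q : TM2.Stmt Γ Bool σ) (p : StackProg Γ σ)

namespace StackProg

/-- The labels that a program needs: one for each block and one for the head of each loop. -/
def Label : StackProg Γ σ → Type
  | block _ => Unit
  | seq p₁ p₂ => p₁.Label ⊕ p₂.Label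
  | loop _ p => Option p.Label

/-- There are finitely many labels. -/
@[reducible]
def fintypeLabel : (p : StackProg Γ σ) → Fintype p.Label
  | block _ => inferInstanceAs (Fintype Unit)
  | seq p₁ p₂ =>
    letI := p₁.fintypeLabel
    letI := p₂.fintypeLabel
    inferInstanceAs (Fintype (p₁.Label ⊕ p₂.Label))
  | loop _ p =>
    letI := p.fintypeLabel
    inferInstanceAs (Fintype (Option p.Label))

/-- The label at which a program starts. -/
def entry : (p : StackProg Γ σ) → p.Label
  | block _ => ()
  | seq p₁ _ => .inl p₁.entry
  | loop _ _ => none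

/-- The statements of a program whose labels are embedded by `e` into the labels of a machine, and
which jumps to the label `x` at its end. -/
def code {Λ : Type} : (p : StackProg Γ σ) → (e : p.Label → Λ) → (x : Λ) → p.Label →
    TM2.Stmt Γ Λ σ
  | block q, _, x, _ => relabel (fun _ => x) q
  | seq p₁ p₂, e, _, .inl l => p₁.code (fun l => e (.inl l)) (e (.inr p₂.entry)) l
  | seq _ p₂, e, x, .inr l => p₂.code (fun l => e (.inr l)) x l
  | loop q p, e, x, none => relabel (fun b => if b then e (some p.entry) else x) q
  | loop _ p, e, _, some l => p.code (fun l => e (some l)) (e none) l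

variable [DecidableEq K]

/-- `Exec p s s' t`: the program `p`, started with internal state and stacks `s`, ends with `s'`
after `t` steps. -/
inductive Exec : StackProg Γ σ → σ × (∀ k, List (Γ k)) → σ × (∀ k, List (Γ k)) → ℕ → Prop
  | block {q v S v' S'} (h : TM2.stepAux q v S = ⟨some (), v', S'⟩) :
      Exec (block q) (v, S) (v', S') 1
  | seq {p₁ p₂ s₁ s₂ s₃ t₁ t₂} (h₁ : Exec p₁ s₁ s₂ t₁) (h₂ : Exec p₂ s₂ s₃ t₂) :
      Exec (seq p₁ p₂) s₁ s₃ (t₁ + t₂)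
  | loop_exit {q p v S v' S'} (h : TM2.stepAux q v S = ⟨some false, v', S'⟩) :
      Exec (loop q p) (v, S) (v', S') 1
  | loop_step {q p v S v' S' s₂ s₃ t₁ t₂} (h : TM2.stepAux q v S = ⟨some true, v', S'⟩)
      (h₁ : Exec p (v', S') s₂ t₁) (h₂ : Exec (loop q p) s₂ s₃ t₂) :
      Exec (loop q p) (v, S) s₃ (1 + t₁ + t₂)

theorem stepAux_relabel {Λ Λ' : Type} (f : Λ → Λ') (q : TM2.Stmt Γ Λ σ) (v : σ)
    (S : ∀ k, List (Γ k)) :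
    TM2.stepAux (relabel f q) v S =
      ⟨(TM2.stepAux q v S).l.map f, (TM2.stepAux q v S).var, (TM2.stepAux q v S).stk⟩ := by
  induction q generalizing v S with
  | branch g q₁ q₂ h₁ h₂ => cases hg : g v <;> simp [relabel, hg, h₁, h₂]
  | _ => simp_all [relabel]

/-- A machine that contains the code of a program carries out the program. -/
theorem Exec.iterate_step {Λ : Type} (M : Λ → TM2.Stmt Γ Λ σ) {p : StackProg Γ σ}
    {s s' : σ × (∀ k, List (Γ k))} {t : ℕ} (h : Exec p s s' t) (e : p.Label → Λ) (x : Λ)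
    (hM : ∀ l, M (e l) = p.code e x l) :
    (flip bind (TM2.step M))^[t] (some ⟨some (e p.entry), s.1, s.2⟩) =
      some ⟨some x, s'.1, s'.2⟩ := by
  induction h generalizing x with
  | @block q v S v' S' h =>
    have hl : M (e (StackProg.block q).entry) = relabel (fun _ => x) q := hM ()
    simp [flip, hl, stepAux_relabel, h]
  | @seq p₁ p₂ _ _ _ t₁ t₂ h₁ h₂ ih₁ ih₂ =>
    rw [Nat.add_comm, Function.iterate_add_apply]
    erw [ih₁ (fun l => e (.inl l)) (e (.inr p₂.entry)) fun l => hM (.inl l)]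
    exact ih₂ (fun l => e (.inr l)) x fun l => hM (.inr l)
  | @loop_exit q p v S v' S' h =>
    have hl : M (e (entry (loop q p))) = relabel (fun b => if b then e (some p.entry) else x) q :=
      hM none
    simp [flip, hl, stepAux_relabel, h]
  | @loop_step q p v S v' S' s₂ s₃ t₁ t₂ h h₁ h₂ ih₁ ih₂ =>
    have hl : M (e (entry (loop q p))) = relabel (fun b => if b then e (some p.entry) else x) q :=
      hM none
    rw [Nat.add_comm, Function.iterate_add_apply, Nat.add_comm, Function.iterate_add_apply]
    have h₀ : (flip bind (TM2.step M))^[1] (some ⟨some (e (loop q p).entry), v, S⟩) =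
        some ⟨some (e (some p.entry)), v', S'⟩ := by
      simp [flip, hl, stepAux_relabel, h]
    erw [h₀, ih₁ (fun l => e (some l)) (e none) fun l => hM (some l)]
    exact ih₂ e x hM

/-- The machine that runs a program and halts, with input stack `k₀` and output stack `k₁`. -/
def machine [Fintype K] [Fintype σ] (p : StackProg Γ σ) (k₀ k₁ : K) (v₀ : σ) [Fintype (Γ k₀)] :
    FinTM2 :=
  letI := p.fintypeLabel
  { K := K
    k₀ := k₀
    k₁ := k₁
    Γ := Γ
    Λ := Option p.Label
    main := some p.entry
    σ := σ
    initialState := v₀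
    m := fun l => match l with
      | none => .halt
      | some l => p.code some none l }

/-- If a program turns the input word, with all other stacks empty, into the output word, with all
other stacks empty, then so does its machine, with one additional step. -/
theorem Exec.outputs [Fintype K] [Fintype σ] {p : StackProg Γ σ} {k₀ k₁ : K} {v₀ : σ}
    [Fintype (Γ k₀)] {l : List (Γ k₀)} {l' : List (Γ k₁)} {t : ℕ}
    (h : Exec p (v₀, Function.update (fun _ => []) k₀ l) (v₀, Function.update (fun _ => []) k₁ l')
      t) :
    Nonempty (TM2OutputsInTime (p.machine k₀ k₁ v₀) l (some l') (t + 1)) := by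
  have hi : ∀ (k : K) (m : List (Γ k)) (d : DecidableEq K),
      (fun k' => @dite (List (Γ k')) (k' = k) (d k' k) (fun h => by rw [h]; exact m)
        fun _ => []) = Function.update (fun _ => []) k m := by
    intro k m d
    funext k'
    by_cases hk : k' = k
    · subst hk; simp
    · simp [hk]
  have key := h.iterate_step (p.machine k₀ k₁ v₀).m some none fun l => rfl
  refine ⟨⟨⟨t + 1, ?_⟩, le_rfl⟩⟩
  rw [Nat.add_comm, Function.iterate_add_apply]
  have h₀ : some (initList (p.machine k₀ k₁ v₀) l) =
      some ⟨some (some p.entry), v₀, Function.update (fun _ => []) k₀ l⟩ := by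
    unfold initList
    exact congrArg (fun S => some (TM2.Cfg.mk (some (some p.entry)) v₀ S)) (hi k₀ l _)
  have h₁ : Option.map (haltList (p.machine k₀ k₁ v₀)) (some l') =
      some ⟨none, v₀, Function.update (fun _ => []) k₁ l'⟩ := by
    unfold haltList
    exact congrArg (fun S => some (TM2.Cfg.mk none v₀ S)) (hi k₁ l' _)
  rw [h₁]
  refine Eq.trans (congrArg _ ((congrArg _ h₀).trans key)) rfl

end StackProg

end StackPrograms

/-! ### Tapes of tokens -/

section Tapes

variable {σ H : Type}

/-- A token consists of a head, which belongs to a finite alphabet, and a name. -/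
abbrev Tok (H : Type) : Type := H × List Bool

/-- The cells of a tape that holds a list of tokens: each token is written as its head followed by
the bits of its name. -/
def flat (ts : List (Tok H)) : List (H ⊕ Bool) :=
  ts.flatMap fun t => .inl t.1 :: t.2.map .inr

@[simp] theorem flat_nil : flat ([] : List (Tok H)) = [] := rfl

@[simp] theorem flat_cons (t : Tok H) (ts : List (Tok H)) :
    flat (t :: ts) = .inl t.1 :: (t.2.map .inr ++ flat ts) := by
  simp [flat]

@[simp] theorem flat_append (ts ts' : List (Tok H)) : flat (ts ++ ts') = flat ts ++ flat ts' := by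
  simp [flat]

theorem length_le_length_flat (ts : List (Tok H)) : ts.length ≤ (flat ts).length := by
  induction ts with
  | nil => simp
  | cons t ts ih => simp; lia

theorem length_flat_congr {ts ts' : List (Tok H)} (h : ts'.map Prod.snd = ts.map Prod.snd) :
    (flat ts').length = (flat ts).length := by
  have key : ∀ ts : List (Tok H), (flat ts).length =
      ((ts.map Prod.snd).map fun u => u.length + 1).sum := by
    intro ts
    induction ts with
    | nil => simp
    | cons t ts ih => simp [ih]; lia
  rw [key, key, h]

/-- A pass from left to right of a finite transducer that reads and rewrites the heads. -/
def pass (g : σ → H → σ × H) : σ → List (Tok H) → σ × List (Tok H)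
  | v, [] => (v, [])
  | v, t :: ts =>
    ((pass g (g v t.1).1 ts).1, ((g v t.1).2, t.2) :: (pass g (g v t.1).1 ts).2)

theorem map_snd_pass (g : σ → H → σ × H) (v : σ) (ts : List (Tok H)) :
    (pass g v ts).2.map Prod.snd = ts.map Prod.snd := by
  induction ts generalizing v with
  | nil => rfl
  | cons t ts ih => simp [pass, ih]

/-- A one-way automaton with a pushdown store of bits. Reading a head `h`, it pushes a bit if
`push h`; otherwise, it pops a bit if `pop h`; otherwise, it only changes its state. -/
structure PDA (σ H : Type) where
  push : H → Bool
  pop : H → Bool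
  bit : σ → Bool
  upd : σ → H → σ
  popUpd : σ → Option Bool → σ

/-- One step of a pushdown automaton. -/
def PDA.step (A : PDA σ H) (s : σ × List Bool) (h : H) : σ × List Bool :=
  if A.push h then (A.upd s.1 h, A.bit s.1 :: s.2)
  else if A.pop h then (A.popUpd s.1 s.2.head?, s.2.tail)
  else (A.upd s.1 h, s.2)

/-- The state in which a pushdown automaton ends after reading the heads of a tape. -/
def PDA.run (A : PDA σ H) (v : σ) (ts : List (Tok H)) : σ :=
  ((ts.map Prod.fst).foldl A.step (v, [])).1

/-- The concatenation of the names of the selected tokens. -/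
def selName (sel : H → Bool) (ts : List (Tok H)) : List Bool :=
  (ts.filter fun t => sel t.1).flatMap Prod.snd

/-- Marking of all tokens whose name is the name of the selected token. -/
def matchName (sel : H → Bool) (mark : H → H) (ts : List (Tok H)) : List (Tok H) :=
  ts.map fun t => (if t.2 = selName sel ts then mark t.1 else t.1, t.2)

end Tapes

/-! ### Running time of programs -/

namespace StackProg

section Runs

variable {K : Type} {Γ : K → Type} {σ : Type} [DecidableEq K]

/-- `Runs p s s' T`: the program `p` leads from `s` to `s'` in at most `T` steps. -/
def Runs (p : StackProg Γ σ) (s s' : σ × (∀ k, List (Γ k))) (T : ℕ) : Prop :=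
  ∃ t ≤ T, Exec p s s' t

theorem Runs.mono {p : StackProg Γ σ} {s s' : σ × (∀ k, List (Γ k))} {T T' : ℕ}
    (h : Runs p s s' T) (hT : T ≤ T') : Runs p s s' T' :=
  let ⟨t, ht, h⟩ := h
  ⟨t, ht.trans hT, h⟩

theorem Runs.seq {p₁ p₂ : StackProg Γ σ} {s₁ s₂ s₃ : σ × (∀ k, List (Γ k))} {T₁ T₂ : ℕ}
    (h₁ : Runs p₁ s₁ s₂ T₁) (h₂ : Runs p₂ s₂ s₃ T₂) : Runs (seq p₁ p₂) s₁ s₃ (T₁ + T₂) :=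
  let ⟨t₁, ht₁, h₁⟩ := h₁
  let ⟨t₂, ht₂, h₂⟩ := h₂
  ⟨t₁ + t₂, add_le_add ht₁ ht₂, h₁.seq h₂⟩

theorem Runs.block {q : TM2.Stmt Γ Unit σ} {s s' : σ × (∀ k, List (Γ k))}
    (h : TM2.stepAux q s.1 s.2 = ⟨some (), s'.1, s'.2⟩) : Runs (block q) s s' 1 :=
  ⟨1, le_rfl, .block h⟩

/-- A loop that consumes a list computes a left fold over this list. Here `conf x l` is the
configuration in which `l` is still to be read and `x` is the accumulated data. -/
theorem Runs.loop_foldl {X A : Type} {q : TM2.Stmt Γ Bool σ} {p : StackProg Γ σ}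
    (conf : X → List A → σ × (∀ k, List (Γ k))) (f : X → A → X) (Inv : X → Prop) (T : ℕ)
    (fin : X → σ × (∀ k, List (Γ k)))
    (hf : ∀ x a, Inv x → Inv (f x a))
    (hstep : ∀ x a l, Inv x → ∃ s, TM2.stepAux q (conf x (a :: l)).1 (conf x (a :: l)).2 =
      ⟨some true, s.1, s.2⟩ ∧ Runs p s (conf (f x a) l) T)
    (hexit : ∀ x, Inv x → TM2.stepAux q (conf x []).1 (conf x []).2 =
      ⟨some false, (fin x).1, (fin x).2⟩)
    (x : X) (hx : Inv x) (l : List A) :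
    Runs (loop q p) (conf x l) (fin (l.foldl f x)) (l.length * (T + 1) + 1) := by
  induction l generalizing x with
  | nil => exact ⟨1, by simp, .loop_exit (hexit x hx)⟩
  | cons a l ih =>
    obtain ⟨s, hs, t, ht, h⟩ := hstep x a l hx
    obtain ⟨t', ht', h'⟩ := ih _ (hf x a hx)
    refine ⟨1 + t + t', ?_, .loop_step hs h h'⟩
    simp only [List.length_cons]
    linarith

end Runs

/-- The program that does nothing. -/
def skip {K : Type} {Γ : K → Type} {σ : Type} : StackProg Γ σ := block (.goto fun _ => ())

theorem runs_skip {K : Type} {Γ : K → Type} {σ : Type} [DecidableEq K]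
    (s : σ × (∀ k, List (Γ k))) : Runs skip s s 1 :=
  .block rfl

end StackProg

/-! ### Operations on tapes that can be carried out in polynomial time -/

/-- The stacks: the input, the two halves of the tape, the counters of the loops that are being
executed, a pushdown store (which also takes the output), and two stacks for names. -/
inductive Stk : Type
  | inp | left | right | cnt | pd | nm | nm'
  deriving DecidableEq

instance : Fintype Stk where
  elems := {.inp, .left, .right, .cnt, .pd, .nm, .nm'}
  complete k := by cases k <;> simp

/-- The alphabets of the stacks. -/
abbrev StkΓ (H : Type) : Stk → Type
  | .inp => Sym
  | .left => H ⊕ Bool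
  | .right => H ⊕ Bool
  | .cnt => Bool
  | .pd => Bool
  | .nm => Bool
  | .nm' => Bool

/-- The internal states: a state of the algorithm together with buffers for symbols that have been
popped. -/
structure Reg (σ H : Type) : Type where
  v : σ
  buf : Option (H ⊕ Bool) := none
  flag : Bool := false
  bit : Option Bool := none
  deriving Fintype

section Operations

variable {σ H : Type}

/-- The stacks with the given contents. -/
def stks (i : List Sym) (l r : List (H ⊕ Bool)) (c p n n' : List Bool) : ∀ k, List (StkΓ H k)
  | .inp => i
  | .left => l
  | .right => r
  | .cnt => c
  | .pd => p
  | .nm => n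
  | .nm' => n'

section

variable (i : List Sym) (l r : List (H ⊕ Bool)) (c p n n' : List Bool)

@[simp] theorem stks_inp : stks i l r c p n n' .inp = i := rfl
@[simp] theorem stks_left : stks i l r c p n n' .left = l := rfl
@[simp] theorem stks_right : stks i l r c p n n' .right = r := rfl
@[simp] theorem stks_cnt : stks i l r c p n n' .cnt = c := rfl
@[simp] theorem stks_pd : stks i l r c p n n' .pd = p := rfl
@[simp] theorem stks_nm : stks i l r c p n n' .nm = n := rfl
@[simp] theorem stks_nm' : stks i l r c p n n' .nm' = n' := rfl

@[simp] theorem update_inp (x : List Sym) :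
    Function.update (stks i l r c p n n') .inp x = stks x l r c p n n' := by
  funext k; cases k <;> rfl
@[simp] theorem update_left (x : List (H ⊕ Bool)) :
    Function.update (stks i l r c p n n') .left x = stks i x r c p n n' := by
  funext k; cases k <;> rfl
@[simp] theorem update_right (x : List (H ⊕ Bool)) :
    Function.update (stks i l r c p n n') .right x = stks i l x c p n n' := by
  funext k; cases k <;> rfl
@[simp] theorem update_cnt (x : List Bool) :
    Function.update (stks i l r c p n n') .cnt x = stks i l r x p n n' := by
  funext k; cases k <;> rfl
@[simp] theorem update_pd (x : List Bool) :
    Function.update (stks i l r c p n n') .pd x = stks i l r c x n n' := by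
  funext k; cases k <;> rfl
@[simp] theorem update_nm (x : List Bool) :
    Function.update (stks i l r c p n n') .nm x = stks i l r c p x n' := by
  funext k; cases k <;> rfl
@[simp] theorem update_nm' (x : List Bool) :
    Function.update (stks i l r c p n n') .nm' x = stks i l r c p n x := by
  funext k; cases k <;> rfl

end

open StackProg

/-- The configuration between two operations: the whole tape is on the right stack, and the
stack of counters has an arbitrary content. -/
def rest (s : σ × List (Tok H)) (C : List Bool) : Reg σ H × (∀ k, List (StkΓ H k)) :=
  ({ v := s.1 }, stks [] [] (flat s.2) C [] [] [])

/-- An operation on tapes is in polynomial time if it can be carried out by a program in a number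
of steps that is polynomial in the length of the tape, and it does not change this length. -/
def PolyTime (F : σ × List (Tok H) → σ × List (Tok H)) : Prop :=
  ∃ (p : StackProg (StkΓ H) (Reg σ H)) (T : Polynomial ℕ), ∀ s C,
    (flat (F s).2).length = (flat s.2).length ∧
      Runs p (rest s C) (rest (F s) C) (T.eval (flat s.2).length)

theorem PolyTime.comp {F G : σ × List (Tok H) → σ × List (Tok H)} (hG : PolyTime G)
    (hF : PolyTime F) : PolyTime fun s => G (F s) := by
  obtain ⟨p, T, hp⟩ := hF
  obtain ⟨q, U, hq⟩ := hG
  refine ⟨.seq p q, T + U, fun s C => ⟨(hq _ C).1.trans (hp s C).1, ?_⟩⟩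
  have h := (hp s C).2.seq (hq (F s) C).2
  rwa [(hp s C).1, ← Polynomial.eval_add] at h

theorem PolyTime.load (f : σ → σ) : PolyTime (H := H) fun s => (f s.1, s.2) :=
  ⟨block (.load (fun x => { v := f x.v }) (.goto fun _ => ())), 1, fun s C => ⟨rfl, by
    simpa using Runs.block rfl⟩⟩

/-- The loop statement of `rewind`. -/
def rewindStmt : TM2.Stmt (StkΓ H) Bool (Reg σ H) :=
  .pop .left (fun x o => { x with buf := o })
    (.branch (fun x => x.buf.isSome)
      (.push .right (fun x => x.buf.getD (.inr false))
        (.load (fun x => { x with buf := none }) (.goto fun _ => true)))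
      (.goto fun _ => false))

/-- The program that moves the tape back to the right stack. -/
def rewind : StackProg (StkΓ H) (Reg σ H) := loop rewindStmt skip

theorem runs_rewind (v : σ) (l r : List (H ⊕ Bool)) (c p n : List Bool) :
    Runs rewind ({ v := v }, stks [] l r c p n [])
      ({ v := v }, stks [] [] (l.reverse ++ r) c p n []) (2 * l.length + 1) := by
  have h := Runs.loop_foldl (X := List (H ⊕ Bool)) (q := rewindStmt) (p := skip)
    (fun r l => (({ v := v } : Reg σ H), stks [] l r c p n []))
    (fun r a => a :: r) (fun _ => True) 1
    (fun r => ({ v := v }, stks [] [] r c p n []))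
    (fun _ _ _ => trivial)
    (fun r a l _ => ⟨_, by simp [rewindStmt], runs_skip _⟩)
    (fun r _ => by simp [rewindStmt]) r trivial l
  rw [List.foldl_flip_cons_eq_append'] at h
  exact h.mono (by lia)

/-! #### Transducers -/

/-- The action of a transducer on a single cell. -/
def passCell (g : σ → H → σ × H) (x : σ × List (H ⊕ Bool)) : H ⊕ Bool → σ × List (H ⊕ Bool)
  | .inl h => ((g x.1 h).1, .inl (g x.1 h).2 :: x.2)
  | .inr b => (x.1, .inr b :: x.2)

theorem foldl_passCell_map_inr (g : σ → H → σ × H) (x : σ × List (H ⊕ Bool)) (u : List Bool) :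
    (u.map .inr).foldl (passCell g) x = (x.1, (u.map .inr).reverse ++ x.2) := by
  induction u generalizing x with
  | nil => rfl
  | cons b u ih => simp [passCell, ih]

theorem foldl_passCell_flat (g : σ → H → σ × H) (v : σ) (l : List (H ⊕ Bool))
    (ts : List (Tok H)) :
    (flat ts).foldl (passCell g) (v, l) =
      ((pass g v ts).1, (flat (pass g v ts).2).reverse ++ l) := by
  induction ts generalizing v l with
  | nil => rfl
  | cons t ts ih =>
    simp [foldl_passCell_map_inr, passCell, ih, pass]

/-- The loop statement of `passProg`. -/
def passStmt (g : σ → H → σ × H) : TM2.Stmt (StkΓ H) Bool (Reg σ H) :=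
  .pop .right (fun x o => match o with
      | none => x
      | some (.inl h) => { x with v := (g x.v h).1, buf := some (.inl (g x.v h).2) }
      | some (.inr b) => { x with buf := some (.inr b) })
    (.branch (fun x => x.buf.isSome)
      (.push .left (fun x => x.buf.getD (.inr false))
        (.load (fun x => { x with buf := none }) (.goto fun _ => true)))
      (.goto fun _ => false))

/-- The program of a transducer. -/
def passProg (g : σ → H → σ × H) : StackProg (StkΓ H) (Reg σ H) :=
  seq (loop (passStmt g) skip) rewind

theorem PolyTime.pass (g : σ → H → σ × H) : PolyTime fun s => SPARQL.pass g s.1 s.2 := by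
  refine ⟨passProg g, 4 * .X + 2, fun s C => ?_⟩
  have hl := length_flat_congr (map_snd_pass g s.1 s.2)
  refine ⟨hl, ?_⟩
  have h := Runs.loop_foldl (X := σ × List (H ⊕ Bool)) (q := passStmt g) (p := skip)
    (fun x r => (({ v := x.1 } : Reg σ H), stks [] x.2 r C [] [] []))
    (passCell g) (fun _ => True) 1
    (fun x => ({ v := x.1 }, stks [] x.2 [] C [] [] []))
    (fun _ _ _ => trivial)
    (fun x a l _ => ⟨_, by cases a <;> simp [passStmt, passCell], runs_skip _⟩)
    (fun r _ => by simp [passStmt]) (s.1, []) trivial (flat s.2)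
  rw [foldl_passCell_flat] at h
  have h' := h.seq (runs_rewind _ _ _ _ _ _)
  simp only [List.append_nil, List.reverse_reverse, List.length_reverse, hl] at h'
  refine h'.mono ?_
  simp
  lia

/-! #### Iteration -/

/-- The loop statement that puts one bit on the stack of counters for each token. -/
def countStmt : TM2.Stmt (StkΓ H) Bool (Reg σ H) :=
  .pop .right (fun x o => { x with buf := o })
    (.branch (fun x => x.buf.isSome)
      (.push .left (fun x => x.buf.getD (.inr false))
        (.branch (fun x => (x.buf.getD (.inr false)).isLeft)
          (.push .cnt (fun _ => true)
            (.load (fun x => { x with buf := none }) (.goto fun _ => true)))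
          (.load (fun x => { x with buf := none }) (.goto fun _ => true))))
      (.goto fun _ => false))

/-- The action of `countStmt` on a single cell. -/
def countCell (x : List (H ⊕ Bool) × List Bool) (a : H ⊕ Bool) : List (H ⊕ Bool) × List Bool :=
  (a :: x.1, if a.isLeft then true :: x.2 else x.2)

theorem foldl_countCell_flat (l : List (H ⊕ Bool)) (C : List Bool) (ts : List (Tok H)) :
    (flat ts).foldl countCell (l, C) =
      ((flat ts).reverse ++ l, List.replicate ts.length true ++ C) := by
  have hu : ∀ (u : List Bool) (l : List (H ⊕ Bool)) (C : List Bool),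
      (u.map .inr).foldl countCell (l, C) = ((u.map .inr).reverse ++ l, C) := by
    intro u
    induction u with
    | nil => simp
    | cons b u ih => simp [countCell, ih]
  induction ts generalizing l C with
  | nil => rfl
  | cons t ts ih =>
    simp [countCell, hu, ih, List.replicate_succ', - List.replicate_append_replicate]

/-- The loop statement that decreases the innermost counter. -/
def tickStmt : TM2.Stmt (StkΓ H) Bool (Reg σ H) :=
  .pop .cnt (fun x o => { x with bit := o })
    (.branch (fun x => x.bit = some true)
      (.load (fun x => { x with bit := none }) (.goto fun _ => true))
      (.load (fun x => { x with bit := none }) (.goto fun _ => false)))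

/-- The counters are kept in unary on a single stack, where they are separated by `false`. As all
programs leave the stack of counters as they found it, loops may be nested. -/
theorem PolyTime.iterate {F : σ × List (Tok H) → σ × List (Tok H)} (hF : PolyTime F) :
    PolyTime fun s => F^[s.2.length] s := by
  obtain ⟨p, T, hp⟩ := hF
  have hlen : ∀ n s, (flat (F^[n] s).2).length = (flat s.2).length := by
    intro n
    induction n with
    | zero => simp
    | succ n ih => intro s; rw [Function.iterate_succ_apply, ih, (hp s []).1]
  have hloop : ∀ (n : ℕ) (s : σ × List (Tok H)) (C : List Bool),
      Runs (loop tickStmt p) (rest s (List.replicate n true ++ false :: C)) (rest (F^[n] s) C)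
        (n * (T.eval (flat s.2).length + 1) + 1) := by
    intro n
    induction n with
    | zero => exact fun s C => ⟨1, by simp, .loop_exit (by simp [tickStmt])⟩
    | succ n ih =>
      intro s C
      obtain ⟨t, ht, h⟩ := (hp s (List.replicate n true ++ false :: C)).2
      obtain ⟨t', ht', h'⟩ := ih (F s) C
      rw [(hp s []).1] at ht'
      refine ⟨1 + t + t', ?_, .loop_step (by simp [tickStmt, List.replicate_succ]) h h'⟩
      linarith
  refine ⟨.seq (block (.push .cnt (fun _ => false) (.goto fun _ => ())))
    (.seq (loop countStmt skip) (.seq rewind (loop tickStmt p))),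
    4 * .X + .X * (T + 1) + 4, fun s C => ⟨hlen _ _, ?_⟩⟩
  have h₁ : Runs (block (.push .cnt (fun _ => false) (.goto fun _ => ()))) (rest s C)
      (rest s (false :: C)) 1 := .block (by simp [rest])
  have h₂ := Runs.loop_foldl (X := List (H ⊕ Bool) × List Bool) (q := countStmt) (p := skip)
    (fun x r => (({ v := s.1 } : Reg σ H), stks [] x.1 r x.2 [] [] []))
    countCell (fun _ => True) 1
    (fun x => ({ v := s.1 }, stks [] x.1 [] x.2 [] [] []))
    (fun _ _ _ => trivial)
    (fun x a l _ => ⟨_, by cases a <;> simp [countStmt, countCell], runs_skip _⟩)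
    (fun r _ => by simp [countStmt]) ([], false :: C) trivial (flat s.2)
  rw [foldl_countCell_flat] at h₂
  have h₃ := runs_rewind s.1 ((flat s.2).reverse ++ []) []
    (List.replicate s.2.length true ++ false :: C) [] []
  simp only [List.append_nil, List.reverse_reverse, List.length_reverse] at h₂ h₃
  have h := h₁.seq (h₂.seq (h₃.seq (hloop s.2.length s C)))
  refine h.mono ?_
  have hn := Nat.mul_le_mul_right (T.eval (flat s.2).length + 1) (length_le_length_flat s.2)
  simp
  lia

/-! #### Pushdown automata -/

/-- The loop statement that empties the pushdown store. -/
def clearPdStmt : TM2.Stmt (StkΓ H) Bool (Reg σ H) :=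
  .pop .pd (fun x o => { x with bit := o })
    (.branch (fun x => x.bit.isSome)
      (.load (fun x => { x with bit := none }) (.goto fun _ => true))
      (.goto fun _ => false))

theorem runs_clearPd (v : σ) (l r : List (H ⊕ Bool)) (c p n : List Bool) :
    Runs (loop clearPdStmt skip) (({ v := v } : Reg σ H), stks [] l r c p n [])
      ({ v := v }, stks [] l r c [] n []) (2 * p.length + 1) := by
  have h := Runs.loop_foldl (X := Unit) (q := clearPdStmt) (p := skip)
    (fun _ p => (({ v := v } : Reg σ H), stks [] l r c p n []))
    (fun _ _ => ()) (fun _ => True) 1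
    (fun _ => ({ v := v }, stks [] l r c [] n []))
    (fun _ _ _ => trivial)
    (fun _ a p _ => ⟨_, by simp [clearPdStmt], runs_skip _⟩)
    (fun _ _ => by simp [clearPdStmt]) () trivial p
  exact h.mono (by lia)

/-- The action of a pushdown automaton on a single cell. -/
def PDA.cell (A : PDA σ H) (x : (σ × List Bool) × List (H ⊕ Bool)) (a : H ⊕ Bool) :
    (σ × List Bool) × List (H ⊕ Bool) :=
  (a.elim (A.step x.1) (fun _ => x.1), a :: x.2)

theorem PDA.foldl_cell_flat (A : PDA σ H) (x : σ × List Bool) (l : List (H ⊕ Bool))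
    (ts : List (Tok H)) :
    (flat ts).foldl A.cell (x, l) =
      ((ts.map Prod.fst).foldl A.step x, (flat ts).reverse ++ l) := by
  have hu : ∀ (u : List Bool) (l : List (H ⊕ Bool)) (x : σ × List Bool),
      (u.map .inr).foldl A.cell (x, l) = (x, (u.map .inr).reverse ++ l) := by
    intro u
    induction u with
    | nil => simp
    | cons b u ih => simp [PDA.cell, ih]
  induction ts generalizing l x with
  | nil => rfl
  | cons t ts ih => simp [PDA.cell, hu, ih]

theorem PDA.length_foldl_step (A : PDA σ H) (x : σ × List Bool) (hs : List H) :
    (hs.foldl A.step x).2.length ≤ x.2.length + hs.length := by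
  induction hs generalizing x with
  | nil => simp
  | cons h hs ih =>
    refine (ih _).trans ?_
    have : (A.step x h).2.length ≤ x.2.length + 1 := by
      unfold PDA.step
      split_ifs <;> simp
      lia
    simp only [List.length_cons]
    lia

/-- The loop statement of a pushdown automaton. -/
def PDA.stmt (A : PDA σ H) : TM2.Stmt (StkΓ H) Bool (Reg σ H) :=
  .pop .right (fun x o => { x with buf := o })
    (.branch (fun x => x.buf.isSome)
      (.push .left (fun x => x.buf.getD (.inr false))
        (.branch (fun x => (x.buf.getD (.inr false)).elim A.push fun _ => false)
          (.push .pd (fun x => A.bit x.v)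
            (.load (fun x => { v := (x.buf.getD (.inr false)).elim (A.upd x.v) fun _ => x.v })
              (.goto fun _ => true)))
          (.branch (fun x => (x.buf.getD (.inr false)).elim A.pop fun _ => false)
            (.pop .pd (fun x o => { v := A.popUpd x.v o }) (.goto fun _ => true))
            (.load (fun x => { v := (x.buf.getD (.inr false)).elim (A.upd x.v) fun _ => x.v })
              (.goto fun _ => true)))))
      (.goto fun _ => false))

theorem PolyTime.run (A : PDA σ H) : PolyTime fun s => (A.run s.1 s.2, s.2) := by
  refine ⟨.seq (loop A.stmt skip) (.seq (loop clearPdStmt skip) rewind), 6 * .X + 3,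
    fun s C => ⟨rfl, ?_⟩⟩
  have h := Runs.loop_foldl (X := (σ × List Bool) × List (H ⊕ Bool)) (q := A.stmt) (p := skip)
    (fun x r => (({ v := x.1.1 } : Reg σ H), stks [] x.2 r C x.1.2 [] []))
    A.cell (fun _ => True) 1
    (fun x => ({ v := x.1.1 }, stks [] x.2 [] C x.1.2 [] []))
    (fun _ _ _ => trivial)
    (fun x a l _ => ⟨A.cell x a |> fun x => ({ v := x.1.1 }, stks [] x.2 l C x.1.2 [] []), by
      cases a with
      | inl h =>
        by_cases h₁ : A.push h = true
        · simp [PDA.stmt, PDA.cell, PDA.step, h₁]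
        · by_cases h₂ : A.pop h = true <;> simp [PDA.stmt, PDA.cell, PDA.step, h₁, h₂]
      | inr b => simp [PDA.stmt, PDA.cell], runs_skip _⟩)
    (fun r _ => by simp [PDA.stmt]) ((s.1, []), []) trivial (flat s.2)
  rw [PDA.foldl_cell_flat] at h
  have h' := h.seq ((runs_clearPd _ _ _ _ _ _).seq (runs_rewind _ _ _ _ _ _))
  simp only [List.append_nil, List.reverse_reverse, List.length_reverse] at h'
  refine h'.mono ?_
  have h₁ := A.length_foldl_step (s.1, []) (s.2.map Prod.fst)
  have h₂ := length_le_length_flat s.2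
  simp at h₁ ⊢
  lia

/-! #### Comparison of names -/

/-- The loop statement that puts the name of the selected token, in reverse order, on the first
stack for names. -/
def copyStmt (sel : H → Bool) : TM2.Stmt (StkΓ H) Bool (Reg σ H) :=
  .pop .right (fun x o => { x with
      buf := o, flag := o.elim x.flag fun a => a.elim sel fun _ => x.flag })
    (.branch (fun x => x.buf.isSome)
      (.push .left (fun x => x.buf.getD (.inr false))
        (.branch (fun x => (x.buf.getD (.inr false)).isRight && x.flag)
          (.push .nm (fun x => (x.buf.getD (.inr false)).elim (fun _ => false) id)
            (.load (fun x => { x with buf := none }) (.goto fun _ => true)))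
          (.load (fun x => { x with buf := none }) (.goto fun _ => true))))
      (.load (fun x => { x with flag := true }) (.goto fun _ => false)))

/-- The action of `copyStmt` on a single cell. -/
def copyCell (sel : H → Bool) (x : Bool × List (H ⊕ Bool) × List Bool) :
    H ⊕ Bool → Bool × List (H ⊕ Bool) × List Bool
  | .inl h => (sel h, .inl h :: x.2.1, x.2.2)
  | .inr b => (x.1, .inr b :: x.2.1, if x.1 then b :: x.2.2 else x.2.2)

theorem foldl_copyCell_flat (sel : H → Bool) (f : Bool) (l : List (H ⊕ Bool)) (n : List Bool)
    (ts : List (Tok H)) :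
    ((flat ts).foldl (copyCell sel) (f, l, n)).2 =
      ((flat ts).reverse ++ l, (selName sel ts).reverse ++ n) := by
  have hu : ∀ (u : List Bool) (f : Bool) (l : List (H ⊕ Bool)) (n : List Bool),
      (u.map .inr).foldl (copyCell sel) (f, l, n) =
        (f, (u.map .inr).reverse ++ l, if f then u.reverse ++ n else n) := by
    intro u
    induction u with
    | nil => simp
    | cons b u ih => intro f l n; cases f <;> simp [copyCell, ih]
  induction ts generalizing f l n with
  | nil => simp [selName]
  | cons t ts ih =>
    cases h : sel t.1 <;> simp [copyCell, hu, ih, selName, h]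

/-- The loop statement that goes back over the tape and compares each name with the one on the
first stack for names. The bits in which both agree are moved to the second stack for names. -/
def compareStmt (mark : H → H) : TM2.Stmt (StkΓ H) Bool (Reg σ H) :=
  .pop .left (fun x o => { x with buf := o })
    (.branch (fun x => x.buf.isSome)
      (.peek .nm (fun x o => { x with
          flag := x.flag && (x.buf.getD (.inr false)).elim (fun _ => o.isNone) (o == some ·) })
        (.push .right (fun x => if x.flag then (x.buf.getD (.inr false)).map mark id else
            x.buf.getD (.inr false))
          (.branch (fun x => x.flag && (x.buf.getD (.inr false)).isRight)
            (.pop .nm (fun x _ => x)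
              (.push .nm' (fun x => (x.buf.getD (.inr false)).elim (fun _ => false) id)
                (.goto fun _ => true)))
            (.goto fun _ => true))))
      (.load (fun x => { v := x.v }) (.goto fun _ => false)))

/-- After a head has been read, the loop with this statement restores the first stack for names. -/
def restoreStmt : TM2.Stmt (StkΓ H) Bool (Reg σ H) :=
  .branch (fun x => (x.buf.getD (.inr false)).isLeft)
    (.pop .nm' (fun x o => { x with bit := o })
      (.branch (fun x => x.bit.isSome)
        (.push .nm (fun x => x.bit.getD false) (.goto fun _ => true))
        (.load (fun x => { v := x.v, flag := true }) (.goto fun _ => false))))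
    (.load (fun x => { x with buf := none }) (.goto fun _ => false))

/-- The action of `compareStmt`, followed by `restoreStmt`, on a single cell. -/
def compareCell (mark : H → H) (x : Bool × List (H ⊕ Bool) × List Bool × List Bool) :
    H ⊕ Bool → Bool × List (H ⊕ Bool) × List Bool × List Bool
  | .inl h => (true, .inl (if x.1 && x.2.2.1.head?.isNone then mark h else h) :: x.2.1,
      x.2.2.2.reverse ++ x.2.2.1, [])
  | .inr b =>
      if x.1 && x.2.2.1.head? == some b then (true, .inr b :: x.2.1, x.2.2.1.tail, b :: x.2.2.2)
      else (false, .inr b :: x.2.1, x.2.2.1, x.2.2.2)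

theorem foldl_compareCell_bits (mark : H → H) (u : List Bool) (f : Bool) (r : List (H ⊕ Bool))
    (n m : List Bool) :
    ∃ f' n' m', (u.map .inr).foldl (compareCell mark) (f, r, n, m) =
        (f', (u.map .inr).reverse ++ r, n', m') ∧ m'.reverse ++ n' = m.reverse ++ n ∧
      ((f' && n'.head?.isNone) = true ↔ f = true ∧ u = n) := by
  induction u generalizing f r n m with
  | nil => exact ⟨f, n, m, by cases n <;> simp⟩
  | cons b u ih =>
    by_cases h : (f && n.head? == some b) = true
    · obtain ⟨rfl, hn⟩ : f = true ∧ n.head? = some b := by simpa using h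
      obtain ⟨n, rfl⟩ : ∃ n', n = b :: n' := by cases n <;> simp_all
      obtain ⟨f', n', m', h₁, h₂, h₃⟩ := ih true (.inr b :: r) n (b :: m)
      exact ⟨f', n', m', by simpa [compareCell] using h₁, by simpa using h₂, by simpa using h₃⟩
    · obtain ⟨f', n', m', h₁, h₂, h₃⟩ := ih false (.inr b :: r) n m
      refine ⟨f', n', m', by simpa [compareCell, h] using h₁, h₂, ?_⟩
      rw [h₃]
      simp only [Bool.false_eq_true, false_and, false_iff, not_and]
      rintro rfl rfl
      simp at h

theorem foldl_compareCell_flat (mark : H → H) (n : List Bool) (r : List (H ⊕ Bool))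
    (ts : List (Tok H)) :
    (flat ts).reverse.foldl (compareCell mark) (true, r, n, []) =
      (true, flat (ts.map fun t => (if t.2.reverse = n then mark t.1 else t.1, t.2)) ++ r,
        n, []) := by
  induction ts using List.reverseRecOn generalizing r with
  | nil => simp
  | append_singleton ts t ih =>
    obtain ⟨f', n', m', h₁, h₂, h₃⟩ := foldl_compareCell_bits mark t.2.reverse true r n []
    simp only [flat_append, flat_cons, flat_nil, List.append_nil, List.reverse_append,
      List.reverse_cons, List.foldl_append, ← List.map_reverse, h₁, List.append_assoc]
    simp only [List.foldl_cons, List.foldl_nil, compareCell, h₂, h₃]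
    simp [ih]

theorem runs_restore (v : σ) (h : H) (f : Bool) (r l : List (H ⊕ Bool)) (C p n m : List Bool)
    (bit : Option Bool) :
    Runs (loop restoreStmt skip)
      (({ v := v, buf := some (.inl h), flag := f, bit := bit } : Reg σ H), stks [] l r C p n m)
      ({ v := v, flag := true }, stks [] l r C p (m.reverse ++ n) []) (2 * m.length + 1) := by
  induction m generalizing n bit with
  | nil => exact ⟨1, by simp, .loop_exit (by simp [restoreStmt])⟩
  | cons b m ih =>
    obtain ⟨t, ht, hr⟩ := ih (b :: n) (some b)
    obtain ⟨t', ht', h'⟩ := runs_skip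
      ((⟨v, some (.inl h), f, some b⟩ : Reg σ H), stks [] l r C p (b :: n) m)
    refine ⟨1 + t' + t, ?_, .loop_step (by simp [restoreStmt]) h' (by simpa using hr)⟩
    simp only [List.length_cons]
    lia

/-- The loop statement that empties the first stack for names. -/
def clearNmStmt : TM2.Stmt (StkΓ H) Bool (Reg σ H) :=
  .pop .nm (fun x o => { x with bit := o })
    (.branch (fun x => x.bit.isSome)
      (.load (fun x => { x with bit := none }) (.goto fun _ => true))
      (.goto fun _ => false))

theorem runs_clearNm (v : σ) (l r : List (H ⊕ Bool)) (c p n : List Bool) :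
    Runs (loop clearNmStmt skip) (({ v := v } : Reg σ H), stks [] l r c p n [])
      ({ v := v }, stks [] l r c p [] []) (2 * n.length + 1) := by
  have h := Runs.loop_foldl (X := Unit) (q := clearNmStmt) (p := skip)
    (fun _ n => (({ v := v } : Reg σ H), stks [] l r c p n []))
    (fun _ _ => ()) (fun _ => True) 1
    (fun _ => ({ v := v }, stks [] l r c p [] []))
    (fun _ _ _ => trivial)
    (fun _ a p _ => ⟨_, by simp [clearNmStmt], runs_skip _⟩)
    (fun _ _ => by simp [clearNmStmt]) () trivial n
  exact h.mono (by lia)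

theorem length_selName_le (sel : H → Bool) (ts : List (Tok H)) :
    (selName sel ts).length ≤ (flat ts).length := by
  induction ts with
  | nil => simp [selName]
  | cons t ts ih =>
    cases h : sel t.1 <;> simp [selName, h] at ih ⊢ <;> lia

theorem PolyTime.matchName (sel : H → Bool) (mark : H → H) :
    PolyTime fun s : σ × List (Tok H) => (s.1, SPARQL.matchName sel mark s.2) := by
  refine ⟨.seq (loop (copyStmt sel) skip)
    (.seq (loop (compareStmt mark) (loop restoreStmt skip)) (loop clearNmStmt skip)),
    (2 * .X + 1) + (.X * (2 * .X + 2) + 1) + (2 * .X + 1), fun s C => ?_⟩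
  refine ⟨length_flat_congr (by simp [SPARQL.matchName, Function.comp_def]), ?_⟩
  have h₁ := Runs.loop_foldl (X := Bool × List (H ⊕ Bool) × List Bool) (q := copyStmt sel)
    (p := skip)
    (fun x r => (({ v := s.1, flag := x.1 } : Reg σ H), stks [] x.2.1 r C [] x.2.2 []))
    (copyCell sel) (fun _ => True) 1
    (fun x => ({ v := s.1, flag := true }, stks [] x.2.1 [] C [] x.2.2 []))
    (fun _ _ _ => trivial)
    (fun x a l _ => ⟨copyCell sel x a |> fun x =>
        (({ v := s.1, flag := x.1 } : Reg σ H), stks [] x.2.1 l C [] x.2.2 []), by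
      cases a with
      | inl h => simp [copyStmt, copyCell]
      | inr b => cases hx : x.1 <;> simp [copyStmt, copyCell, hx], runs_skip _⟩)
    (fun r _ => by simp [copyStmt]) (false, [], []) trivial (flat s.2)
  rw [foldl_copyCell_flat] at h₁
  have hN := length_selName_le sel s.2
  have h₂ := Runs.loop_foldl (X := Bool × List (H ⊕ Bool) × List Bool × List Bool)
    (q := compareStmt mark) (p := loop restoreStmt skip)
    (fun x l => (({ v := s.1, flag := x.1 } : Reg σ H), stks [] l x.2.1 C [] x.2.2.1 x.2.2.2))
    (compareCell mark) (fun x => x.2.2.1.length + x.2.2.2.length ≤ (flat s.2).length)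
    (2 * (flat s.2).length + 1)
    (fun x => ({ v := s.1 }, stks [] [] x.2.1 C [] x.2.2.1 x.2.2.2))
    (fun x a hx => by
      cases a with
      | inl h => simp [compareCell]; lia
      | inr b =>
        simp only [compareCell]
        split_ifs with h
        · obtain ⟨_, hn⟩ : x.1 = true ∧ x.2.2.1.head? = some b := by simpa using h
          obtain ⟨n, hn⟩ : ∃ n', x.2.2.1 = b :: n' := by cases hx : x.2.2.1 <;> simp_all
          simp [hn] at hx ⊢
          lia
        · exact hx)
    (fun x a l hx => by
      cases a with
      | inl h =>
        refine ⟨_, ?_, (runs_restore s.1 h (x.1 && x.2.2.1.head?.isNone)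
          (.inl (if x.1 && x.2.2.1.head?.isNone then mark h else h) :: x.2.1) l C [] x.2.2.1
          x.2.2.2 none).mono (by lia)⟩
        by_cases hc : (x.1 && x.2.2.1.head?.isNone) = true <;> simp [compareStmt, hc]
      | inr b =>
        refine ⟨compareCell mark x (.inr b) |> fun x =>
          (({ v := s.1, buf := some (.inr b), flag := x.1 } : Reg σ H),
            stks [] l x.2.1 C [] x.2.2.1 x.2.2.2), ?_, ⟨1, by lia, .loop_exit ?_⟩⟩
        · by_cases hc : (x.1 && x.2.2.1.head? == some b) = true <;>
            simp [compareStmt, compareCell, hc]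
        · simp [restoreStmt])
    (fun x _ => by simp [compareStmt]) (true, [], (selName sel s.2).reverse, [])
    (by simpa using hN) (flat s.2).reverse
  rw [foldl_compareCell_flat] at h₂
  simp only [List.append_nil, List.reverse_inj, List.length_reverse] at h₁ h₂
  have h := h₁.seq (h₂.seq (runs_clearNm _ _ _ _ _ _))
  refine h.mono ?_
  simp
  lia

/-! #### Decision problems -/

/-- The initial tape: bits belong to names, and all other symbols are heads. -/
def inputCell (c : Sym → H) : Sym → H ⊕ Bool
  | .bit b => .inr b
  | a => .inl (c a)

/-- The loop statement that reads the input. -/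
def inputStmt (c : Sym → H) : TM2.Stmt (StkΓ H) Bool (Reg σ H) :=
  .pop .inp (fun x o => { x with buf := o.map (inputCell c) })
    (.branch (fun x => x.buf.isSome)
      (.push .left (fun x => x.buf.getD (.inr false))
        (.load (fun x => { x with buf := none }) (.goto fun _ => true)))
      (.goto fun _ => false))

/-- The loop statement that removes the tape. -/
def eraseStmt : TM2.Stmt (StkΓ H) Bool (Reg σ H) :=
  .pop .right (fun x o => { x with buf := o })
    (.branch (fun x => x.buf.isSome)
      (.load (fun x => { x with buf := none }) (.goto fun _ => true))
      (.goto fun _ => false))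

/-- A property is checkable in polynomial time if it can be read off from the state in which an
operation in polynomial time ends, when it starts with the input on its tape. -/
theorem PolyTime.checkable [Fintype σ] [Fintype H] {F : σ × List (Tok H) → σ × List (Tok H)}
    (hF : PolyTime F) {α : Type} (e : Computability.Encoding α Sym) (p : α → Prop)
    (c : Sym → H) (v₀ : σ) (toks : α → List (Tok H))
    (htoks : ∀ a, flat (toks a) = (e.encode a).map (inputCell c)) (acc : σ → Bool)
    (hp : ∀ a, acc (F (v₀, toks a)).1 = true ↔ p a) : CheckableInPolyTime e p := by
  classical
  obtain ⟨q, T, hq⟩ := hF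
  let prog : StackProg (StkΓ H) (Reg σ H) := .seq (loop (inputStmt c) skip) (.seq rewind (.seq q
    (.seq (loop eraseStmt skip) (block (.push .pd (fun x => acc x.v)
      (.load (fun _ => { v := v₀ }) (.goto fun _ => ())))))))
  have hstk : ∀ (k : Stk) (l : List (StkΓ H k)), Function.update (fun _ => []) k l =
      Function.update (stks [] [] [] [] [] [] []) k l := by
    intro k l
    congr 1
    funext k; cases k <;> rfl
  let _ : Fintype (StkΓ H .inp) := inferInstanceAs (Fintype Sym)
  have key : ∀ a, Nonempty (TM2OutputsInTime (prog.machine .inp .pd { v := v₀ }) (e.encode a)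
      (some [decide (p a)]) ((6 * .X + T + 5 : Polynomial ℕ).eval (e.encode a).length)) := by
    intro a
    have hl : (flat (toks a)).length = (e.encode a).length := by simp [htoks]
    have h₁ := Runs.loop_foldl (X := List (H ⊕ Bool)) (q := inputStmt c) (p := skip)
      (fun l i => (({ v := v₀ } : Reg σ H), stks i l [] [] [] [] []))
      (fun l x => inputCell c x :: l) (fun _ => True) 1
      (fun l => ({ v := v₀ }, stks [] l [] [] [] [] []))
      (fun _ _ _ => trivial)
      (fun x a l _ => ⟨_, by simp [inputStmt], runs_skip _⟩)
      (fun r _ => by simp [inputStmt]) [] trivial (e.encode a)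
    have hfold : ∀ (w : List Sym) (l : List (H ⊕ Bool)),
        w.foldl (fun l x => inputCell c x :: l) l = (w.map (inputCell c)).reverse ++ l := by
      intro w
      induction w with
      | nil => simp
      | cons x w ih => simp [ih]
    rw [hfold, ← htoks] at h₁
    have h₂ := runs_rewind v₀ ((flat (toks a)).reverse ++ []) [] [] [] []
    simp only [List.append_nil, List.reverse_reverse, List.length_reverse] at h₁ h₂
    have h₃ := (hq (v₀, toks a) []).2
    have h₄ := Runs.loop_foldl (X := Unit) (q := eraseStmt) (p := skip)
      (fun _ r => (({ v := (F (v₀, toks a)).1 } : Reg σ H), stks [] [] r [] [] [] []))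
      (fun _ _ => ()) (fun _ => True) 1
      (fun _ => ({ v := (F (v₀, toks a)).1 }, stks [] [] [] [] [] [] []))
      (fun _ _ _ => trivial)
      (fun _ a p _ => ⟨_, by simp [eraseStmt], runs_skip _⟩)
      (fun _ _ => by simp [eraseStmt]) () trivial (flat (F (v₀, toks a)).2)
    have h₅ : Runs (Γ := StkΓ H) (block (.push .pd (fun x => acc x.v)
        (.load (fun _ => { v := v₀ }) (.goto fun _ => ()))))
        (({ v := (F (v₀, toks a)).1 } : Reg σ H), stks [] [] [] [] [] [] [])
        ({ v := v₀ }, stks [] [] [] [] [decide (p a)] [] []) 1 :=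
      .block (by simp [← hp a])
    obtain ⟨t, ht, h⟩ := h₁.seq (h₂.seq (h₃.seq (h₄.seq h₅)))
    have hout := Exec.outputs (k₀ := Stk.inp) (k₁ := Stk.pd) (v₀ := ({ v := v₀ } : Reg σ H))
      (l := e.encode a) (l' := [decide (p a)]) (p := prog) (t := t)
      (by rw [hstk, hstk, update_inp, update_pd]; exact h)
    refine hout.map fun o => ⟨o.toEvalsTo, o.steps_le_m.trans ?_⟩
    rw [(hq (v₀, toks a) []).1] at ht
    simp only [hl] at ht
    simp
    lia
  exact ⟨⟨⟨prog.machine .inp .pd { v := v₀ }, Equiv.refl _, Equiv.refl _⟩,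
    6 * .X + T + 5, fun a => by
      erw [List.map_id, List.map_id]
      exact (key a).some⟩⟩

end Operations

/-! ### The tokens of a pattern -/

section Tokens

variable {I L V : Type}

/-- The symbols that occur in words of AF-patterns, except for names and the symbols before
them. -/
inductive Punct : Type
  | endMark | lpar | rpar | kwAnd | kwFilter | kwBound | kwNotBound | kwEq | kwNeq

/-- A punctuation symbol, seen as an input symbol. -/
def Punct.sym : Punct → Sym
  | endMark => .endMark
  | lpar => .lpar
  | rpar => .rpar
  | kwAnd => .kwAnd
  | kwFilter => .kwFilter
  | kwBound => .kwBound
  | kwNotBound => .kwNotBound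
  | kwEq => .kwEq
  | kwNeq => .kwNeq

/-- Whether a symbol is one of those that come before names. -/
def Sym.isAtom : Sym → Bool
  | .iri => true
  | .lit => true
  | .var => true
  | _ => false

@[simp] theorem Sym.isAtom_endMark : Sym.endMark.isAtom = false := rfl
@[simp] theorem Sym.isAtom_lpar : Sym.lpar.isAtom = false := rfl
@[simp] theorem Sym.isAtom_rpar : Sym.rpar.isAtom = false := rfl
@[simp] theorem Sym.isAtom_kwAnd : Sym.kwAnd.isAtom = false := rfl
@[simp] theorem Sym.isAtom_kwFilter : Sym.kwFilter.isAtom = false := rfl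
@[simp] theorem Sym.isAtom_kwBound : Sym.kwBound.isAtom = false := rfl
@[simp] theorem Sym.isAtom_kwNotBound : Sym.kwNotBound.isAtom = false := rfl
@[simp] theorem Sym.isAtom_kwEq : Sym.kwEq.isAtom = false := rfl
@[simp] theorem Sym.isAtom_kwNeq : Sym.kwNeq.isAtom = false := rfl

@[simp] theorem Punct.isAtom_sym (s : Punct) : s.sym.isAtom = false := by cases s <;> rfl

/-- The symbol that comes before the name of a term. -/
def PatTerm.sym : PatTerm I L V → Sym
  | .iri _ => .iri
  | .lit _ => .lit
  | .var _ => .var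

@[simp] theorem PatTerm.isAtom_sym (a : PatTerm I L V) : a.sym.isAtom = true := by
  cases a <;> rfl

/-- A constant, seen as an element of `I ∪ L ∪ V`. -/
def Const.toPatTerm (V : Type) : Const I L → PatTerm I L V
  | .iri i => .iri i
  | .lit l => .lit l

/-- Abstract tokens: the words of patterns are regarded as lists of punctuation symbols and
of terms. -/
inductive ATok (I L V : Type) : Type
  | punct (s : Punct)
  | atom (a : PatTerm I L V)

/-- The symbol of a token. -/
def ATok.sym : ATok I L V → Sym
  | punct s => s.sym
  | atom a => a.sym

@[simp] theorem ATok.sym_punct (s : Punct) : (punct s : ATok I L V).sym = s.sym := rfl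
@[simp] theorem ATok.sym_atom (a : PatTerm I L V) : (atom a).sym = a.sym := rfl

/-- The tokens of a constraint. -/
def Constraint.atoks : Constraint I L V → List (ATok I L V)
  | .bound x => [.punct .kwBound, .atom (.var x), .punct .endMark]
  | .notBound x => [.punct .kwNotBound, .atom (.var x), .punct .endMark]
  | .eq x y => [.atom (.var x), .punct .endMark, .punct .kwEq, .atom (.var y), .punct .endMark]
  | .neq x y _ => [.atom (.var x), .punct .endMark, .punct .kwNeq, .atom (.var y), .punct .endMark]
  | .eqConst x c =>
    [.atom (.var x), .punct .endMark, .punct .kwEq, .atom (c.toPatTerm V), .punct .endMark]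
  | .neqConst x c =>
    [.atom (.var x), .punct .endMark, .punct .kwNeq, .atom (c.toPatTerm V), .punct .endMark]

/-- The tokens of an AF-pattern. (The value for other patterns is irrelevant.) -/
def Pattern.atoks : Pattern I L V → List (ATok I L V)
  | .triple u v w => [.punct .lpar, .atom u, .punct .endMark, .atom (v.toPatTerm L),
      .punct .endMark, .atom w, .punct .endMark, .punct .rpar]
  | .and P Q => .punct .lpar :: (P.atoks ++ .punct .kwAnd :: (Q.atoks ++ [.punct .rpar]))
  | .filter P C => .punct .lpar :: (P.atoks ++ .punct .kwFilter :: (C.atoks ++ [.punct .rpar]))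
  | .union _ _ => []
  | .opt _ _ => []

section Names

variable (eI : Computability.Encoding I Bool) (eL : Computability.Encoding L Bool)
  (eV : Computability.Encoding V Bool)

/-- The name of a term. -/
def PatTerm.name : PatTerm I L V → List Bool
  | .iri i => eI.encode i
  | .lit l => eL.encode l
  | .var x => eV.encode x

theorem PatTerm.sym_name_inj {a b : PatTerm I L V} (hs : a.sym = b.sym)
    (hn : a.name eI eL eV = b.name eI eL eV) : a = b := by
  cases a <;> cases b <;> simp only [PatTerm.sym, reduceCtorEq] at hs
  · exact congrArg _ (eI.encode_injective hn)
  · exact congrArg _ (eL.encode_injective hn)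
  · exact congrArg _ (eV.encode_injective hn)

/-- The name of a token; punctuation symbols have an empty name. -/
def ATok.name : ATok I L V → List Bool
  | .punct _ => []
  | .atom a => a.name eI eL eV

@[simp] theorem ATok.name_punct (s : Punct) :
    (punct s : ATok I L V).name eI eL eV = [] := rfl
@[simp] theorem ATok.name_atom (a : PatTerm I L V) :
    (atom a).name eI eL eV = a.name eI eL eV := rfl

theorem flat_map_atoks {H : Type} (c : Sym → H) {P : Pattern I L V} (hP : P.IsAF) :
    flat (P.atoks.map fun t => (c t.sym, t.name eI eL eV)) =
      (P.word eI eL eV).map (inputCell c) := by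
  have hname : ∀ w : List Bool, (nameWord w).map (inputCell c) =
      w.map .inr ++ [.inl (c .endMark)] := by
    intro w
    simp [nameWord, inputCell]
  have hC : ∀ C : Constraint I L V, flat (C.atoks.map fun t => (c t.sym, t.name eI eL eV)) =
      (C.word eI eL eV).map (inputCell c) := by
    intro C
    cases C with
    | eqConst x a | neqConst x a =>
      cases a <;> simp [Constraint.atoks, Constraint.word, Const.word, Const.toPatTerm, varWord,
        iriWord, litWord, hname, PatTerm.name, PatTerm.sym, Punct.sym, inputCell]
    | _ =>
      simp [Constraint.atoks, Constraint.word, varWord, hname, PatTerm.name,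
        PatTerm.sym, Punct.sym, inputCell]
  induction P with
  | triple u v w =>
    cases u <;> cases v <;> cases w <;>
      simp [Pattern.atoks, Pattern.word, PatTerm.word, PredTerm.word, PredTerm.toPatTerm, varWord,
        iriWord, litWord, hname, PatTerm.name, PatTerm.sym, Punct.sym, inputCell]
  | and P Q ihP ihQ =>
    simp [Pattern.atoks, Pattern.word, ihP hP.1, ihQ hP.2, Punct.sym, inputCell]
  | filter P C ih =>
    simp [Pattern.atoks, Pattern.word, ih hP, hC, Punct.sym, inputCell]
  | union | opt => exact hP.elim

end Names

/-! ### The automata of the algorithm -/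

/-- The pairs of terms between which a constraint requires an equality (for `e = true`) or an
inequality (for `e = false`). -/
def Constraint.pairs (e : Bool) : Constraint I L V → List (PatTerm I L V × PatTerm I L V)
  | .eq x y => if e then [(.var x, .var y)] else []
  | .neq x y _ => if e then [] else [(.var x, .var y)]
  | .eqConst x c => if e then [(.var x, c.toPatTerm V)] else []
  | .neqConst x c => if e then [] else [(.var x, c.toPatTerm V)]
  | _ => []

/-- The pairs of terms between which the constraints of a pattern require an equality (for
`e = true`) or an inequality (for `e = false`). -/
def Pattern.pairs (e : Bool) : Pattern I L V → List (PatTerm I L V × PatTerm I L V)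
  | .and P Q => P.pairs e ++ Q.pairs e
  | .filter P C => P.pairs e ++ C.pairs e
  | _ => []

/-- The symbol that stands between the two terms of these pairs. -/
def pairSym : Bool → Sym
  | true => .kwEq
  | false => .kwNeq

/-- The terms in the first two positions of the triple patterns. -/
def Pattern.nonLits : Pattern I L V → List (PatTerm I L V)
  | .triple u v _ => [u, v.toPatTerm L]
  | .and P Q => P.nonLits ++ Q.nonLits
  | .filter P _ => P.nonLits
  | _ => []

/-- The terms in the triple patterns. -/
def Pattern.tripleTerms : Pattern I L V → List (PatTerm I L V)
  | .triple u v w => [u, v.toPatTerm L, w]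
  | .and P Q => P.tripleTerms ++ Q.tripleTerms
  | .filter P _ => P.tripleTerms
  | _ => []

/-- The variables that a constraint requires to be bound. -/
def Constraint.posVars : Constraint I L V → List (PatTerm I L V)
  | .bound x => [.var x]
  | .notBound _ => []
  | .eq x y => [.var x, .var y]
  | .neq x y _ => [.var x, .var y]
  | .eqConst x _ => [.var x]
  | .neqConst x _ => [.var x]

/-- The variables that a constraint requires not to be bound. -/
def Constraint.negVars : Constraint I L V → List (PatTerm I L V)
  | .notBound x => [.var x]
  | _ => []

/-- For a set of variables with at most one element `x`, given by its characteristic function `n`: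
whether some filter condition of the pattern fails because `x` occurs or does not occur in the
triple patterns in the scope of the filter. -/
def Pattern.scopeBad (n : PatTerm I L V → Bool) : Pattern I L V → Bool
  | .and P Q => P.scopeBad n || Q.scopeBad n
  | .filter P C => P.scopeBad n || (C.posVars.any n && !P.tripleTerms.any n) ||
      (C.negVars.any n && P.tripleTerms.any n)
  | _ => false

/-- The state of the automaton that looks for certain pairs: what is known about the last term,
whether the symbol in question has been read since, and whether such a pair has been found. -/
structure PairSt : Type where
  la : Bool := false
  lb : Bool := false
  flag : Bool := false
  hit : Bool := false
  deriving Fintype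

/-- The automaton that looks for two terms with the symbol `op` between them, of which one has
property `A` and the other one has property `B`. -/
def pairUpd (op : Sym) (v : PairSt) (s : Sym) (A B : Bool) : PairSt :=
  if s.isAtom then
    { la := A, lb := B, hit := v.hit || (v.flag && ((v.la && B) || (v.lb && A))) }
  else if s = .endMark then v
  else if s = op then { v with flag := true }
  else { hit := v.hit }

/-- The state of the automaton that recognizes subjects and predicates: whether the next term is a
subject or a predicate, and whether a term as required has been found. -/
structure RoleSt : Type where
  subj : Bool := false
  pred : Bool := false
  hit : Bool := false
  deriving Fintype

/-- The automaton that looks for a term with property `A` in the first two positions of a triple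
pattern. -/
def roleUpd (v : RoleSt) (s : Sym) (A : Bool) : RoleSt :=
  if s.isAtom then { pred := v.subj, hit := v.hit || ((v.subj || v.pred) && A) }
  else if s = .endMark then v
  else if s = .lpar then { subj := true, hit := v.hit }
  else { hit := v.hit }

/-- The state of the pushdown automaton that checks the scopes: whether the variable has been found
in the triple patterns since the last unmatched parenthesis, whether the current constraint
requires variables to be bound or not to be bound, and whether a violation has been found. -/
structure ScopeSt : Type where
  cur : Bool := false
  pos : Bool := false
  neg : Bool := false
  bad : Bool := false
  deriving Fintype

/-- The transition function of the pushdown automaton that checks the scopes, where `A` tells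
whether the symbol belongs to the variable in question. A comparison requires its variables to be
bound, hence `kwFilter` turns on `pos`. At an opening parenthesis `cur` goes to the pushdown store,
so that within a pair of parentheses `cur` refers to the triple patterns in this pair only. -/
def scopeUpd (v : ScopeSt) (s : Sym) (A : Bool) : ScopeSt :=
  if s.isAtom then
    if v.pos then { v with bad := v.bad || (A && !v.cur) }
    else if v.neg then { v with bad := v.bad || (A && v.cur) }
    else { v with cur := v.cur || A }
  else if s = .lpar then { bad := v.bad }
  else if s = .kwFilter then { v with pos := true, neg := false }
  else if s = .kwNotBound then { v with pos := false, neg := true }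
  else v

/-- The transition function at closing parentheses. -/
def scopePop (v : ScopeSt) (o : Option Bool) : ScopeSt :=
  { cur := v.cur || o.getD false, bad := v.bad }

/-- The pushdown automaton on symbols, together with its pushdown store. -/
def scopeStep (v : ScopeSt × List Bool) (s : Sym) (A : Bool) : ScopeSt × List Bool :=
  if s = .lpar then (scopeUpd v.1 s A, v.1.cur :: v.2)
  else if s = .rpar then (scopePop v.1 v.2.head?, v.2.tail)
  else (scopeUpd v.1 s A, v.2)

/-- The property of a token that it is a term with the property `A`. -/
def ATok.sat (A : PatTerm I L V → Bool) : ATok I L V → Bool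
  | .punct _ => false
  | .atom a => A a

@[simp] theorem ATok.sat_punct (A : PatTerm I L V → Bool) (s : Punct) :
    (punct s).sat A = false := rfl
@[simp] theorem ATok.sat_atom (A : PatTerm I L V → Bool) (a : PatTerm I L V) :
    (atom a).sat A = A a := rfl

theorem foldl_pairUpd_atoks (e : Bool) (A B : PatTerm I L V → Bool) {P : Pattern I L V}
    (hP : P.IsAF) (v : PairSt) :
    P.atoks.foldl (fun v t => pairUpd (pairSym e) v t.sym (t.sat A) (t.sat B)) v =
      { hit := v.hit || (P.pairs e).any fun c => (A c.1 && B c.2) || (B c.1 && A c.2) } := by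
  induction P generalizing v with
  | triple u p w =>
    cases e <;> simp [Pattern.atoks, Pattern.pairs, pairUpd, pairSym, Punct.sym]
  | and P Q ihP ihQ =>
    simp only [Pattern.atoks, Pattern.pairs, List.foldl_cons, List.foldl_append, ihP hP.1,
      ihQ hP.2]
    cases e <;> simp [pairUpd, pairSym, Punct.sym, Bool.or_assoc]
  | filter P C ih =>
    simp only [Pattern.atoks, Pattern.pairs, List.foldl_cons, List.foldl_append,
      ih (show P.IsAF from hP)]
    cases e <;> cases C <;>
      simp [Constraint.atoks, Constraint.pairs, pairUpd, pairSym, Punct.sym, Bool.or_assoc]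
  | union | opt => exact hP.elim

theorem foldl_roleUpd_atoks (A : PatTerm I L V → Bool) {P : Pattern I L V} (hP : P.IsAF)
    (v : RoleSt) :
    P.atoks.foldl (fun v t => roleUpd v t.sym (t.sat A)) v =
      { hit := v.hit || P.nonLits.any A } := by
  induction P generalizing v with
  | triple u p w =>
    simp [Pattern.atoks, Pattern.nonLits, roleUpd, Punct.sym, Bool.or_assoc]
  | and P Q ihP ihQ =>
    simp only [Pattern.atoks, Pattern.nonLits, List.foldl_cons, List.foldl_append, ihP hP.1,
      ihQ hP.2]
    simp [roleUpd, Punct.sym, Bool.or_assoc]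
  | filter P C ih =>
    simp only [Pattern.atoks, Pattern.nonLits, List.foldl_cons, List.foldl_append,
      ih (show P.IsAF from hP)]
    cases C <;> simp [Constraint.atoks, roleUpd, Punct.sym]
  | union | opt => exact hP.elim

theorem foldl_scopeStep_atoks (n : PatTerm I L V → Bool) (hn : ∀ c : Const I L,
    n (c.toPatTerm V) = false) {P : Pattern I L V} (hP : P.IsAF) (cur bad : Bool)
    (D : List Bool) :
    P.atoks.foldl (fun v t => scopeStep v t.sym (t.sat n)) ({ cur := cur, bad := bad }, D) =
      ({ cur := cur || P.tripleTerms.any n, bad := bad || P.scopeBad n }, D) := by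
  induction P generalizing cur bad D with
  | triple u p w =>
    have h : ∀ a : PatTerm I L V, a.sym ≠ .lpar ∧ a.sym ≠ .rpar := by
      intro a; cases a <;> simp [PatTerm.sym]
    simp [Pattern.atoks, Pattern.tripleTerms, Pattern.scopeBad, scopeStep, scopeUpd, scopePop,
      Punct.sym, h]
    grind
  | and P Q ihP ihQ =>
    have h₁ : scopeStep ({ cur := cur, bad := bad }, D) .lpar false =
      ({ bad := bad }, cur :: D) := by simp [scopeStep, scopeUpd]
    have h₂ : ∀ v D, scopeStep (v, D) .kwAnd false = (v, D) := by simp [scopeStep, scopeUpd]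
    simp only [Pattern.atoks, List.foldl_cons, List.foldl_append, ATok.sym_punct, Punct.sym,
      ATok.sat_punct, h₁, h₂, ihP hP.1, ihQ hP.2]
    simp [Pattern.tripleTerms, Pattern.scopeBad, scopeStep, scopePop, Bool.or_assoc, Bool.or_comm]
  | filter P C ih =>
    have h : ∀ a : PatTerm I L V, a.sym ≠ .lpar ∧ a.sym ≠ .rpar := by
      intro a; cases a <;> simp [PatTerm.sym]
    have h₁ : scopeStep ({ cur := cur, bad := bad }, D) .lpar false =
      ({ bad := bad }, cur :: D) := by simp [scopeStep, scopeUpd]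
    simp only [Pattern.atoks, List.foldl_cons, List.foldl_append, ATok.sym_punct, Punct.sym,
      ATok.sat_punct, h₁, ih (show P.IsAF from hP)]
    cases C <;> simp [Pattern.tripleTerms, Pattern.scopeBad, Constraint.atoks,
      Constraint.posVars, Constraint.negVars, scopeStep, scopeUpd, scopePop, Punct.sym, h,
      hn] <;> grind
  | union | opt => exact hP.elim

end Tokens

/-! ### The algorithm -/

/-- The heads of the tape: a symbol with marks. The marks `p` and `q` point to the tokens that are
being considered in the outer and the inner loop, `x` marks the occurrences of the term at one of
these positions, `n` marks the occurrences of the term considered in the outer loop, and `m` marks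
the terms that are known to be equal to it. -/
structure Head : Type where
  sym : Sym
  p : Bool := false
  q : Bool := false
  x : Bool := false
  n : Bool := false
  m : Bool := false
  deriving Fintype

/-- The state of the pass that checks the class of terms with mark `m`: the state of the automaton
that looks for subjects and predicates, and whether a literal in the class, an occurrence of a
constant with mark `n`, and another constant in the class have been found. -/
structure ClassSt : Type where
  role : RoleSt := {}
  lit : Bool := false
  const : Bool := false
  other : Bool := false
  deriving Fintype

/-- The control states. `rej` tells whether the pattern has been found to be unsatisfiable; all
other components have default values between two operations. -/
structure Ctl : Type where
  rej : Bool := false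
  carry : Bool := false
  kind : Option Sym := none
  pair : PairSt := {}
  scope : ScopeSt := {}
  cls : ClassSt := {}
  deriving Fintype

/-- States of the algorithm. -/
abbrev AState : Type := Ctl × List (Tok Head)

/-! #### Passes without rewriting -/

theorem pass_read {σ H : Type} (f : σ → H → σ) (v : σ) (ts : List (Tok H)) :
    pass (fun v h => (f v h, h)) v ts = ((ts.map Prod.fst).foldl f v, ts) := by
  induction ts generalizing v with
  | nil => rfl
  | cons t ts ih => simp [pass, ih]

theorem pass_map {σ H : Type} (f : σ → H → H) (v : σ) (ts : List (Tok H)) :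
    pass (fun v h => (v, f v h)) v ts = (v, ts.map fun t => (f v t.1, t.2)) := by
  induction ts with
  | nil => rfl
  | cons t ts ih => simp [pass, ih]

/-! #### Loops over all tokens -/

/-- A mark on the heads. -/
structure Mark (H : Type) where
  get : H → Bool
  set : H → Bool → H
  get_set : ∀ h b, get (set h b) = b
  set_get : ∀ h, set h (get h) = h
  set_set : ∀ h b c, set (set h b) c = set h c

/-- The mark of the outer loop. -/
def markP : Mark Head where
  get h := h.p
  set h b := { h with p := b }
  get_set _ _ := rfl
  set_get _ := rfl
  set_set _ _ _ := rfl

/-- The mark of the inner loop. -/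
def markQ : Mark Head where
  get h := h.q
  set h b := { h with q := b }
  get_set _ _ := rfl
  set_get _ := rfl
  set_set _ _ _ := rfl

namespace Mark

variable (k : Mark Head)

/-- Setting of the mark at the token with the given index, if there is such a token. -/
def setAt (i : ℕ) (ts : List (Tok Head)) : List (Tok Head) :=
  ts.modify i fun t => (k.set t.1 true, t.2)

/-- The pass that moves the mark to the next token, or sets it at the first token if `carry` is
set. -/
def shift (s : AState) : AState :=
  let s' := pass (fun v h => ({ v with carry := k.get h }, k.set h v.carry)) s.1 s.2
  ({ s'.1 with carry := false }, s'.2)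

/-- Execution of `F` for each token, with the mark at this token. -/
def forEach (F : AState → AState) (s : AState) : AState :=
  (fun s => (fun s => k.shift (F s))^[s.2.length] s) (k.shift ({ s.1 with carry := true }, s.2))

theorem polyTime_shift : PolyTime k.shift :=
  .comp (F := fun s : AState =>
      pass (fun v h => ({ v with carry := k.get h }, k.set h v.carry)) s.1 s.2)
    (.load fun v : Ctl => { v with carry := false }) (.pass _)

theorem polyTime_forEach {F : AState → AState} (hF : PolyTime F) : PolyTime (k.forEach F) :=
  (k.polyTime_shift.comp hF).iterate.comp
    (k.polyTime_shift.comp (.load fun v : Ctl => { v with carry := true }))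

variable {k}

theorem pass_shift_clean (v : Ctl) {ts : List (Tok Head)} (h : ∀ t ∈ ts, k.get t.1 = false) :
    ∃ c, pass (fun v h => ({ v with carry := k.get h }, k.set h v.carry)) v ts =
      ({ v with carry := c }, if v.carry then k.setAt 0 ts else ts) := by
  induction ts generalizing v with
  | nil => exact ⟨v.carry, by simp [pass, Mark.setAt]⟩
  | cons t ts ih =>
    have ht := h t (by simp)
    obtain ⟨c, hc⟩ := ih { v with carry := k.get t.1 } fun t ht => h t (by simp [ht])
    refine ⟨c, ?_⟩
    simp only [pass, hc]
    cases hv : v.carry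
    · have : k.set t.1 false = t.1 := by rw [← ht, k.set_get]
      simp [ht, this]
    · simp [ht, Mark.setAt]

theorem pass_shift_setAt (v : Ctl) (hv : v.carry = false) {ts : List (Tok Head)}
    (h : ∀ t ∈ ts, k.get t.1 = false) (i : ℕ) :
    ∃ c, pass (fun v h => ({ v with carry := k.get h }, k.set h v.carry)) v (k.setAt i ts) =
      ({ v with carry := c }, k.setAt (i + 1) ts) := by
  induction ts generalizing v i with
  | nil => exact ⟨v.carry, by simp [pass, Mark.setAt]⟩
  | cons t ts ih =>
    have ht := h t (by simp)
    have ht' : k.set t.1 false = t.1 := by rw [← ht, k.set_get]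
    cases i with
    | zero =>
      obtain ⟨c, hc⟩ := pass_shift_clean (k := k) { v with carry := true } (ts := ts)
        fun t ht => h t (by simp [ht])
      refine ⟨c, ?_⟩
      simp only [Mark.setAt, List.modify_zero_cons, pass, k.get_set, hc, k.set_set, hv, ht',
        List.modify_succ_cons]
      simp
    | succ i =>
      obtain ⟨c, hc⟩ := ih { v with carry := false } rfl (fun t ht => h t (by simp [ht])) i
      refine ⟨c, ?_⟩
      simp only [Mark.setAt, List.modify_succ_cons, pass, ht, hv, ht'] at hc ⊢
      rw [hc]

theorem shift_setAt {v : Ctl} (hv : v.carry = false) {ts : List (Tok Head)}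
    (h : ∀ t ∈ ts, k.get t.1 = false) (i : ℕ) :
    k.shift (v, k.setAt i ts) = (v, k.setAt (i + 1) ts) := by
  obtain ⟨c, hc⟩ := pass_shift_setAt v hv h i
  simp only [shift, hc]
  rw [← hv]

theorem shift_first {v : Ctl} (hv : v.carry = false) {ts : List (Tok Head)}
    (h : ∀ t ∈ ts, k.get t.1 = false) :
    k.shift ({ v with carry := true }, ts) = (v, k.setAt 0 ts) := by
  obtain ⟨c, hc⟩ := pass_shift_clean (k := k) { v with carry := true } h
  simp only [shift, hc]
  rw [← hv]
  rfl

/-- A loop over all tokens computes a left fold, if its body acts on the states `conf x` with a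
mark at one token. -/
theorem forEach_eq_foldl {X Y : Type} {F : AState → AState} (conf : X → AState) (f : X → Y → X)
    (l : List Y) (hlen : ∀ x, (conf x).2.length = l.length)
    (hclean : ∀ x, ∀ t ∈ (conf x).2, k.get t.1 = false) (hcarry : ∀ x, (conf x).1.carry = false)
    (hF : ∀ x i y, l[i]? = some y →
      F ((conf x).1, k.setAt i (conf x).2) = ((conf (f x y)).1, k.setAt i (conf (f x y)).2))
    (x : X) :
    k.forEach F (conf x) = conf (l.foldl f x) := by
  have key : ∀ i ≤ l.length, (fun s => k.shift (F s))^[i] ((conf x).1, k.setAt 0 (conf x).2) =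
      ((conf ((l.take i).foldl f x)).1, k.setAt i (conf ((l.take i).foldl f x)).2) := by
    intro i hi
    induction i with
    | zero => rfl
    | succ i ih =>
      rw [Function.iterate_succ_apply', ih (by lia), hF _ i l[i] (List.getElem?_eq_getElem hi),
        shift_setAt (hcarry _) (hclean _), ← List.take_append_getElem hi, List.foldl_append]
      rfl
  have hs := shift_first (hcarry x) (hclean x)
  have hend := key l.length le_rfl
  have hl : (k.setAt 0 (conf x).2).length = l.length := by simp [Mark.setAt, hlen]
  rw [List.take_length] at hend
  simp only [forEach]
  rw [hs]
  simp only [hl, hend]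
  have : k.setAt l.length (conf (l.foldl f x)).2 = (conf (l.foldl f x)).2 := by
    rw [Mark.setAt, ← hlen (l.foldl f x)]
    simp [List.modify_eq_self]
  rw [this]

end Mark

/-! #### The operations -/

/-- The pass that reads the kind of the selected token. -/
def fetch (sel : Head → Bool) (s : AState) : AState :=
  pass (fun v h => (if sel h && h.sym.isAtom then { v with kind := some h.sym } else v, h)) s.1 s.2

/-- Mark `x` at all occurrences of the term at the selected token. -/
def same (sel : Head → Bool) (s : AState) : AState :=
  let s := fetch sel s
  let s : AState := (s.1, matchName sel (fun h => { h with x := true }) s.2)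
  let s := pass (fun v h => (v, { h with x := h.x && v.kind = some h.sym })) s.1 s.2
  ({ s.1 with kind := none }, s.2)

/-- Mark `m` at all tokens with mark `x`, if there is an equality constraint between a term with
mark `x` and a term with mark `m`. -/
def grow (s : AState) : AState :=
  let s := pass (fun v h =>
    ({ v with pair := pairUpd (pairSym true) v.pair h.sym h.x h.m }, h)) s.1 s.2
  let s := pass (fun v h => (v, { h with m := h.m || (v.pair.hit && h.x), x := false })) s.1 s.2
  ({ s.1 with pair := {} }, s.2)

/-- Replace the marks `x` by marks `n` and `m`. -/
def start (s : AState) : AState :=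
  pass (fun v h => (v, { h with n := h.x, m := h.x, x := false })) s.1 s.2

/-- The pushdown automaton that checks the scopes with respect to the variable with mark `n`. -/
def scopePDA : PDA Ctl Head where
  push h := h.sym = .lpar
  pop h := h.sym = .rpar
  bit v := v.scope.cur
  upd v h := { v with scope := scopeUpd v.scope h.sym (h.n && h.sym = .var) }
  popUpd v o := { v with scope := scopePop v.scope o }

/-- Check of the scopes. -/
def checkScope (s : AState) : AState :=
  ({ scopePDA.run s.1 s.2 with
      rej := (scopePDA.run s.1 s.2).rej || (scopePDA.run s.1 s.2).scope.bad, scope := {} }, s.2)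

/-- Whether a symbol comes before the name of a constant. -/
def Sym.isConst (s : Sym) : Bool := s.isAtom && s ≠ .var

/-- The transition function of the pass that checks the marks `m`. -/
def classUpd (v : Ctl) (h : Head) : Ctl :=
  { v with
    pair := pairUpd (pairSym false) v.pair h.sym h.m h.m
    cls :=
      { role := roleUpd v.cls.role h.sym h.m
        lit := v.cls.lit || (h.m && h.sym = .lit)
        const := v.cls.const || (h.n && h.sym.isConst)
        other := v.cls.other || (h.m && !h.n && h.sym.isConst) } }

/-- Check of the class of terms with mark `m`. -/
def checkClass (s : AState) : AState :=
  let s := pass (fun v h => (classUpd v h, h)) s.1 s.2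
  ({ rej := s.1.rej || s.1.pair.hit || (s.1.cls.lit && s.1.cls.role.hit) ||
      (s.1.cls.const && s.1.cls.other) }, s.2)

/-- Removal of the marks `n` and `m`. -/
def clear (s : AState) : AState :=
  pass (fun v h => (v, { h with x := false, n := false, m := false })) s.1 s.2

/-- A round of the propagation of the marks `m`. -/
def round : AState → AState := markQ.forEach fun s => grow (same Head.q s)

/-- The test of the term at the token with mark `p`. -/
def testTerm (s : AState) : AState :=
  clear (checkClass ((fun s => round^[s.2.length] s)
    (checkScope (start (same Head.p s)))))

/-- The test of all terms. -/
def testPattern : AState → AState := markP.forEach testTerm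

theorem polyTime_same (sel : Head → Bool) : PolyTime (same sel) := by
  have h₁ : PolyTime (fetch sel) := .pass _
  have h₂ : PolyTime fun s : AState =>
    (s.1, matchName sel (fun h => { h with x := true }) s.2) := .matchName _ _
  have h₃ : PolyTime fun s : AState =>
    pass (fun v h => (v, { h with x := h.x && v.kind = some h.sym })) s.1 s.2 := .pass _
  have h₄ : PolyTime fun s : AState => ({ s.1 with kind := none }, s.2) :=
    .load fun v : Ctl => { v with kind := none }
  exact h₄.comp (h₃.comp (h₂.comp h₁))

theorem polyTime_grow : PolyTime grow := by
  have h₁ : PolyTime fun s : AState => pass (fun v h =>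
    ({ v with pair := pairUpd (pairSym true) v.pair h.sym h.x h.m }, h)) s.1 s.2 := .pass _
  have h₂ : PolyTime fun s : AState => pass (fun v h =>
    (v, { h with m := h.m || (v.pair.hit && h.x), x := false })) s.1 s.2 := .pass _
  have h₃ : PolyTime fun s : AState => ({ s.1 with pair := {} }, s.2) :=
    .load fun v : Ctl => { v with pair := {} }
  exact h₃.comp (h₂.comp h₁)

theorem polyTime_checkScope : PolyTime checkScope :=
  .comp (F := fun s : AState => (scopePDA.run s.1 s.2, s.2))
    (.load fun v : Ctl => { v with rej := v.rej || v.scope.bad, scope := {} }) (.run _)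

theorem polyTime_checkClass : PolyTime checkClass :=
  .comp (F := fun s : AState => pass (fun v h => (classUpd v h, h)) s.1 s.2)
    (.load fun v : Ctl => { rej := v.rej || v.pair.hit || (v.cls.lit && v.cls.role.hit) ||
      (v.cls.const && v.cls.other) }) (.pass _)

theorem polyTime_testPattern : PolyTime testPattern := by
  have hround : PolyTime round := markQ.polyTime_forEach (polyTime_grow.comp (polyTime_same _))
  have hstart : PolyTime start := .pass _
  have hclear : PolyTime clear := .pass _
  exact markP.polyTime_forEach (hclear.comp (polyTime_checkClass.comp (hround.iterate.comp
    (polyTime_checkScope.comp (hstart.comp (polyTime_same _))))))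

/-! ### Effect of the operations on the tape of a pattern -/

section Effect

variable {I L V : Type} (eI : Computability.Encoding I Bool) (eL : Computability.Encoding L Bool)
  (eV : Computability.Encoding V Bool)

/-- A token, with the marks `p` and `q` given explicitly and the other marks given by sets of
terms (in the form of their characteristic functions). -/
def markedTok (X N S : PatTerm I L V → Bool) (y : ATok I L V × Bool × Bool) : Tok Head :=
  ({ sym := y.1.sym, p := y.2.1, q := y.2.2, x := y.1.sat X, n := y.1.sat N, m := y.1.sat S },
    y.1.name eI eL eV)

/-- The state of the algorithm with given sets of terms with marks `x`, `n` and `m`. -/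
def conf (r : Bool) (X N S : PatTerm I L V → Bool) (b : List (ATok I L V × Bool × Bool)) : AState :=
  ({ rej := r }, b.map (markedTok eI eL eV X N S))

open Classical in
/-- The set that contains the term at a token, if there is one. -/
noncomputable def ATok.single : ATok I L V → PatTerm I L V → Bool
  | .punct _, _ => false
  | .atom a, c => decide (c = a)

/-- The token `y` is the only one that is selected; the pass over its name and the pass over the kinds
of the tokens together identify the occurrences of its term. -/
theorem same_conf (sel : Head → Bool) (r : Bool) (N S : PatTerm I L V → Bool)
    (s : ATok I L V × Bool × Bool → Bool)
    (hs : ∀ X z, sel (markedTok eI eL eV X N S z).1 = s z)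
    (b₁ b₂ : List (ATok I L V × Bool × Bool)) (y : ATok I L V × Bool × Bool) (hy : s y = true)
    (h₁ : ∀ z ∈ b₁, s z = false) (h₂ : ∀ z ∈ b₂, s z = false) :
    same sel (conf eI eL eV r (fun _ => false) N S (b₁ ++ y :: b₂)) =
      conf eI eL eV r y.1.single N S (b₁ ++ y :: b₂) := by
  have hfold : ∀ (b : List (ATok I L V × Bool × Bool)) (v : Ctl), (∀ z ∈ b, s z = false) →
      ((b.map (markedTok eI eL eV (fun _ => false) N S)).map Prod.fst).foldl
        (fun v h => if sel h && h.sym.isAtom then { v with kind := some h.sym } else v) v = v := by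
    intro b v hb
    induction b generalizing v with
    | nil => rfl
    | cons z b ih =>
      simp only [List.map_cons, List.foldl_cons, hs, hb z (by simp), Bool.false_and,
        Bool.false_eq_true, if_false]
      exact ih v fun z hz => hb z (by simp [hz])
  have hsel : ∀ b : List (ATok I L V × Bool × Bool), (∀ z ∈ b, s z = false) →
      (b.map (markedTok eI eL eV (fun _ => false) N S)).filter (fun t => sel t.1) = [] := by
    intro b hb
    simp only [List.filter_eq_nil_iff, List.mem_map]
    rintro _ ⟨z, hz, rfl⟩
    simp [hs, hb z hz]
  have hname : selName sel ((b₁ ++ y :: b₂).map (markedTok eI eL eV (fun _ => false) N S)) =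
      y.1.name eI eL eV := by
    simp only [selName, List.map_append, List.filter_append, hsel b₁ h₁, List.map_cons,
      List.filter_cons, hs, hy, if_true, hsel b₂ h₂]
    simp [markedTok]
  have hkind : fetch sel (conf eI eL eV r (fun _ => false) N S (b₁ ++ y :: b₂)) =
      ({ rej := r, kind := if y.1.sym.isAtom then some y.1.sym else none },
        (b₁ ++ y :: b₂).map (markedTok eI eL eV (fun _ => false) N S)) := by
    unfold fetch conf
    rw [pass_read]
    congr 1
    simp only [List.map_append, List.foldl_append, hfold b₁ _ h₁, List.map_cons, List.foldl_cons,
      hs, hy, Bool.true_and, hfold b₂ _ h₂]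
    by_cases h : y.1.sym.isAtom = true <;> simp [markedTok, h]
  have hif : ∀ (c : Prop) [Decidable c] (h : Head),
      (if c then { h with x := true } else h) = { h with x := h.x || decide c } := by
    intro c _ h
    split_ifs with hc <;> simp [hc]
  unfold same
  simp only [hkind, matchName, hname, pass_map, hif]
  simp only [conf, List.map_map]
  refine congrArg _ (List.map_congr_left fun z _ => ?_)
  obtain ⟨z, zp, zq⟩ := z
  obtain ⟨y, yp, yq⟩ := y
  cases z with
  | punct c =>
    have : ∀ a : PatTerm I L V, a.sym ≠ c.sym := by
      intro a h
      have := a.isAtom_sym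
      simp [h] at this
    cases y <;> simp [markedTok, this]
  | atom a =>
    cases y with
    | punct c => simp [markedTok, ATok.single]
    | atom c =>
      by_cases hac : a = c
      · subst hac
        simp [markedTok, ATok.single]
      · have : a.name eI eL eV = c.name eI eL eV → ¬ c.sym = a.sym :=
          fun h h' => hac (PatTerm.sym_name_inj eI eL eV h'.symm h)
        simp [markedTok, ATok.single, hac]
        exact fun h => this (of_decide_eq_true h)

/-- Whether some equality constraint is between an element of `X` and an element of `S`. -/
def Pattern.meets (P : Pattern I L V) (X S : PatTerm I L V → Bool) : Bool :=
  (P.pairs true).any fun c => (X c.1 && S c.2) || (S c.1 && X c.2)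

theorem grow_conf {P : Pattern I L V} (hP : P.IsAF) {b : List (ATok I L V × Bool × Bool)}
    (hb : b.map Prod.fst = P.atoks) (r : Bool) (X N S : PatTerm I L V → Bool) :
    grow (conf eI eL eV r X N S b) =
      conf eI eL eV r (fun _ => false) N (fun a => S a || (P.meets X S && X a)) b := by
  have hfold : ∀ (b : List (ATok I L V × Bool × Bool)) (v : Ctl),
      ((b.map (markedTok eI eL eV X N S)).map Prod.fst).foldl (fun v h =>
        { v with pair := pairUpd (pairSym true) v.pair h.sym h.x h.m }) v =
      { v with
        pair := (b.map Prod.fst).foldl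
          (fun v t => pairUpd (pairSym true) v t.sym (t.sat X) (t.sat S)) v.pair } := by
    intro b v
    induction b generalizing v with
    | nil => rfl
    | cons z b ih => exact ih _
  unfold grow
  simp only [conf, pass_read, hfold, hb, foldl_pairUpd_atoks true X S hP, pass_map]
  simp only [List.map_map]
  refine congrArg _ (List.map_congr_left fun z _ => ?_)
  obtain ⟨z, zp, zq⟩ := z
  cases z <;> simp [markedTok, Pattern.meets]

theorem start_conf (r : Bool) (X N S : PatTerm I L V → Bool)
    (b : List (ATok I L V × Bool × Bool)) :
    start (conf eI eL eV r X N S b) = conf eI eL eV r (fun _ => false) X X b := by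
  unfold start
  simp only [conf, pass_map, List.map_map]
  refine congrArg _ (List.map_congr_left fun z _ => ?_)
  obtain ⟨z, zp, zq⟩ := z
  cases z <;> simp [markedTok]

theorem clear_conf (r : Bool) (X N S : PatTerm I L V → Bool)
    (b : List (ATok I L V × Bool × Bool)) :
    clear (conf eI eL eV r X N S b) =
      conf eI eL eV r (fun _ => false) (fun _ => false) (fun _ => false) b := by
  unfold clear
  simp only [conf, pass_map, List.map_map]
  refine congrArg _ (List.map_congr_left fun z _ => ?_)
  obtain ⟨z, zp, zq⟩ := z
  cases z <;> simp [markedTok]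

theorem checkScope_conf {P : Pattern I L V} (hP : P.IsAF) {b : List (ATok I L V × Bool × Bool)}
    (hb : b.map Prod.fst = P.atoks) (r : Bool) (X N S : PatTerm I L V → Bool) :
    checkScope (conf eI eL eV r X N S b) =
      conf eI eL eV (r || P.scopeBad fun a => N a && a.sym = .var) X N S b := by
  have hfold : ∀ (b : List (ATok I L V × Bool × Bool)) (v : Ctl) (D : List Bool),
      ((b.map (markedTok eI eL eV X N S)).map Prod.fst).foldl scopePDA.step (v, D) =
      ({ v with scope := ((b.map Prod.fst).foldl
        (fun v t => scopeStep v t.sym (t.sat fun a => N a && a.sym = .var)) (v.scope, D)).1 },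
        ((b.map Prod.fst).foldl
        (fun v t => scopeStep v t.sym (t.sat fun a => N a && a.sym = .var)) (v.scope, D)).2) := by
    intro b v D
    induction b generalizing v D with
    | nil => rfl
    | cons z b ih =>
      obtain ⟨z, zp, zq⟩ := z
      have hstep : scopePDA.step (v, D) (markedTok eI eL eV X N S (z, zp, zq)).1 =
          ({ v with scope := (scopeStep (v.scope, D) z.sym
              (z.sat fun a => N a && a.sym = .var)).1 },
            (scopeStep (v.scope, D) z.sym (z.sat fun a => N a && a.sym = .var)).2) := by
        have : (z.sat N && decide (z.sym = .var)) = z.sat fun a => N a && a.sym = .var := by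
          cases z <;> rfl
        simp only [PDA.step, scopePDA, markedTok, scopeStep, this]
        by_cases h₁ : z.sym = .lpar
        · simp [h₁]
        · by_cases h₂ : z.sym = .rpar
          · simp [h₂]
          · simp [h₁, h₂]
      simp only [List.map_cons, List.foldl_cons, hstep, ih]
  have hc : ∀ c : Const I L,
      (N (c.toPatTerm V) && decide ((c.toPatTerm V).sym = .var)) = false := by
    intro c
    cases c <;> simp [Const.toPatTerm, PatTerm.sym]
  unfold checkScope PDA.run
  simp only [conf, hfold, hb]
  rw [foldl_scopeStep_atoks (fun a => N a && a.sym = .var) hc hP false false []]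
  simp

/-- Whether the class `S` of terms that are required to be equal to the element of `N` violates a
condition: an inequality is required between two elements of `S`; or `S` contains a literal and a
term that must not be a literal; or the element of `N` is a constant and `S` contains another
constant. -/
def Pattern.classBad (P : Pattern I L V) (N S : PatTerm I L V → Bool) : Bool :=
  (P.pairs false).any (fun c => S c.1 && S c.2) ||
  (P.atoks.any (fun t => t.sat S && t.sym = .lit) && P.nonLits.any S) ||
  (P.atoks.any (fun t => t.sat N && t.sym.isConst) &&
    P.atoks.any (fun t => t.sat S && !t.sat N && t.sym.isConst))

theorem checkClass_conf {P : Pattern I L V} (hP : P.IsAF) {b : List (ATok I L V × Bool × Bool)}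
    (hb : b.map Prod.fst = P.atoks) (r : Bool) (X N S : PatTerm I L V → Bool) :
    checkClass (conf eI eL eV r X N S b) = conf eI eL eV (r || P.classBad N S) X N S b := by
  have hfold : ∀ (b : List (ATok I L V × Bool × Bool)) (v : Ctl),
      ((b.map (markedTok eI eL eV X N S)).map Prod.fst).foldl classUpd v =
      { v with
        pair := (b.map Prod.fst).foldl
          (fun v t => pairUpd (pairSym false) v t.sym (t.sat S) (t.sat S)) v.pair
        cls :=
          { role := (b.map Prod.fst).foldl (fun v t => roleUpd v t.sym (t.sat S)) v.cls.role
            lit := v.cls.lit || (b.map Prod.fst).any (fun t => t.sat S && t.sym = .lit)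
            const := v.cls.const || (b.map Prod.fst).any (fun t => t.sat N && t.sym.isConst)
            other := v.cls.other ||
              (b.map Prod.fst).any (fun t => t.sat S && !t.sat N && t.sym.isConst) } } := by
    intro b v
    induction b generalizing v with
    | nil => simp
    | cons z b ih =>
      simp only [List.map_cons, List.foldl_cons, ih, List.any_cons]
      simp [classUpd, markedTok, Bool.or_assoc]
      rfl
  unfold checkClass
  simp only [conf, pass_read]
  simp only [hfold, hb, foldl_pairUpd_atoks false S S hP, foldl_roleUpd_atoks S hP]
  simp [Pattern.classBad, Bool.or_assoc]

end Effect

/-! ### Effect of the loops -/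

section Loops

variable {I L V : Type}

/-- A round of the propagation of marks `m`: for every term `a` in turn, if an equality is required
between `a` and an element of the set, then `a` is added to the set. -/
noncomputable def Pattern.growAll (P : Pattern I L V) (S : PatTerm I L V → Bool) :
    PatTerm I L V → Bool :=
  P.atoks.foldl (fun S t a => S a || (P.meets t.single S && t.single a)) S

/-- The class of a term, as computed by the algorithm. -/
noncomputable def Pattern.classOf (P : Pattern I L V) (t : ATok I L V) : PatTerm I L V → Bool :=
  P.growAll^[P.atoks.length] t.single

/-- Whether the test of the term at a token fails. -/
noncomputable def Pattern.termBad (P : Pattern I L V) (t : ATok I L V) : Bool :=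
  P.scopeBad (fun a => t.single a && a.sym = .var) || P.classBad t.single (P.classOf t)

variable (eI : Computability.Encoding I Bool) (eL : Computability.Encoding L Bool)
  (eV : Computability.Encoding V Bool)

theorem exists_eq_append_of_getElem? {α : Type} {l : List α} {i : ℕ} {a : α}
    (h : l[i]? = some a) : ∃ l₁ l₂, l = l₁ ++ a :: l₂ ∧ i = l₁.length := by
  obtain ⟨hi, rfl⟩ := List.getElem?_eq_some_iff.1 h
  exact ⟨l.take i, l.drop (i + 1), by simp, by simp; lia⟩

theorem modify_append_cons {α : Type} {i : ℕ} {l₁ l₂ : List α} {a : α} (f : α → α)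
    (h : i = l₁.length) : (l₁ ++ a :: l₂).modify i f = l₁ ++ f a :: l₂ := by
  subst h
  induction l₁ with
  | nil => rfl
  | cons b l₁ ih => simp [ih]

theorem round_conf {P : Pattern I L V} (hP : P.IsAF) {b : List (ATok I L V × Bool × Bool)}
    (hb : b.map Prod.fst = P.atoks) (hq : ∀ z ∈ b, z.2.2 = false) (r : Bool)
    (N S : PatTerm I L V → Bool) :
    round (conf eI eL eV r (fun _ => false) N S b) =
      conf eI eL eV r (fun _ => false) N (P.growAll S) b := by
  refine Mark.forEach_eq_foldl (fun S => conf eI eL eV r (fun _ => false) N S b)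
    (fun S t a => S a || (P.meets t.single S && t.single a)) P.atoks ?_ ?_ (fun _ => rfl) ?_ S
  · intro S
    simp [conf, ← hb]
  · intro S t ht
    obtain ⟨z, hz, rfl⟩ := List.mem_map.1 ht
    exact hq z hz
  · intro S i t ht
    rw [← hb, List.getElem?_map] at ht
    obtain ⟨⟨t, p, q⟩, hz, rfl⟩ := Option.map_eq_some_iff.1 ht
    obtain ⟨b₁, b₂, rfl, rfl⟩ := exists_eq_append_of_getElem? hz
    have hset : ∀ S, ((conf eI eL eV r (fun _ => false) N S (b₁ ++ (t, p, q) :: b₂)).1,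
        markQ.setAt b₁.length (conf eI eL eV r (fun _ => false) N S (b₁ ++ (t, p, q) :: b₂)).2) =
        conf eI eL eV r (fun _ => false) N S (b₁ ++ (t, p, true) :: b₂) := by
      intro S
      simp only [conf, Mark.setAt, List.map_append, List.map_cons]
      rw [modify_append_cons _ (by simp)]
      rfl
    simp only [hset]
    rw [same_conf eI eL eV Head.q r N S (fun z => z.2.2) (fun _ _ => rfl) b₁ b₂ (t, p, true) rfl
        (fun z hz => hq z (by simp [hz])) (fun z hz => hq z (by simp [hz])),
      grow_conf eI eL eV hP (by simpa using hb)]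

theorem iterate_round_conf {P : Pattern I L V} (hP : P.IsAF)
    {b : List (ATok I L V × Bool × Bool)} (hb : b.map Prod.fst = P.atoks)
    (hq : ∀ z ∈ b, z.2.2 = false) (r : Bool) (N S : PatTerm I L V → Bool) (i : ℕ) :
    round^[i] (conf eI eL eV r (fun _ => false) N S b) =
      conf eI eL eV r (fun _ => false) N (P.growAll^[i] S) b := by
  induction i generalizing S with
  | zero => rfl
  | succ i ih => rw [Function.iterate_succ_apply, round_conf eI eL eV hP hb hq, ih]; rfl

theorem testTerm_conf {P : Pattern I L V} (hP : P.IsAF) (r : Bool)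
    (b₁ b₂ : List (ATok I L V × Bool × Bool)) (t : ATok I L V)
    (hb : (b₁ ++ (t, true, false) :: b₂).map Prod.fst = P.atoks)
    (h₁ : ∀ z ∈ b₁, z.2 = (false, false)) (h₂ : ∀ z ∈ b₂, z.2 = (false, false)) :
    testTerm (conf eI eL eV r (fun _ => false) (fun _ => false) (fun _ => false)
        (b₁ ++ (t, true, false) :: b₂)) =
      conf eI eL eV (r || P.termBad t) (fun _ => false) (fun _ => false) (fun _ => false)
        (b₁ ++ (t, true, false) :: b₂) := by
  have hq : ∀ z ∈ b₁ ++ (t, true, false) :: b₂, z.2.2 = false := by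
    intro z hz
    simp only [List.mem_append, List.mem_cons] at hz
    rcases hz with hz | rfl | hz
    · rw [h₁ z hz]
    · rfl
    · rw [h₂ z hz]
  have hlen : ∀ r X N S, (conf eI eL eV r X N S (b₁ ++ (t, true, false) :: b₂)).2.length =
      P.atoks.length := by
    intro r X N S
    simp only [conf, ← hb, List.length_map]
  unfold testTerm
  rw [same_conf eI eL eV Head.p r _ _ (fun z => z.2.1) (fun _ _ => rfl) b₁ b₂ (t, true, false) rfl
      (fun z hz => by rw [h₁ z hz]) (fun z hz => by rw [h₂ z hz]), start_conf,
    checkScope_conf eI eL eV hP hb]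
  simp only [hlen]
  rw [iterate_round_conf eI eL eV hP hb hq, checkClass_conf eI eL eV hP hb, clear_conf,
    Bool.or_assoc]
  rfl

/-- The result of the whole procedure, started on the tape of a pattern without marks. -/
theorem testPattern_conf {P : Pattern I L V} (hP : P.IsAF) :
    (testPattern ({}, P.atoks.map fun t => ({ sym := t.sym }, t.name eI eL eV))).1.rej =
      P.atoks.any P.termBad := by
  let b : List (ATok I L V × Bool × Bool) := P.atoks.map fun t => (t, false, false)
  have hb : b.map Prod.fst = P.atoks := by simp [b, Function.comp_def]
  have hclean : ∀ z ∈ b, z.2 = (false, false) := by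
    intro z hz
    obtain ⟨t, _, rfl⟩ := List.mem_map.1 hz
    rfl
  have hinit : (({}, P.atoks.map fun t => ({ sym := t.sym }, t.name eI eL eV)) : AState) =
      conf eI eL eV false (fun _ => false) (fun _ => false) (fun _ => false) b := by
    simp only [conf, b, List.map_map]
    refine congrArg _ (List.map_congr_left fun t _ => ?_)
    cases t <;> rfl
  have hfold : ∀ (l : List (ATok I L V)) (r : Bool),
      l.foldl (fun r t => r || P.termBad t) r = (r || l.any P.termBad) := by
    intro l r
    induction l generalizing r with
    | nil => simp
    | cons t l ih => simp [ih, Bool.or_assoc]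
  have := Mark.forEach_eq_foldl (k := markP) (F := testTerm)
    (fun r => conf eI eL eV r (fun _ => false) (fun _ => false) (fun _ => false) b)
    (fun r t => r || P.termBad t) P.atoks ?_ ?_ (fun _ => rfl) ?_ false
  · rw [hinit, testPattern, this, hfold]
    simp [conf]
  · intro r
    simp [conf, b]
  · intro r t ht
    obtain ⟨z, hz, rfl⟩ := List.mem_map.1 ht
    exact congrArg Prod.fst (hclean z hz)
  · intro r i t ht
    rw [← hb, List.getElem?_map] at ht
    obtain ⟨⟨t, p, q⟩, hz, rfl⟩ := Option.map_eq_some_iff.1 ht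
    obtain ⟨b₁, b₂, hb', rfl⟩ := exists_eq_append_of_getElem? hz
    rw [hb'] at hb hclean
    obtain ⟨rfl, rfl⟩ : p = false ∧ q = false := by
      simpa using hclean (t, p, q) (by simp)
    have hset : ∀ r, ((conf eI eL eV r (fun _ => false) (fun _ => false) (fun _ => false) b).1,
        markP.setAt b₁.length
          (conf eI eL eV r (fun _ => false) (fun _ => false) (fun _ => false) b).2) =
        conf eI eL eV r (fun _ => false) (fun _ => false) (fun _ => false)
          (b₁ ++ (t, true, false) :: b₂) := by
      intro r
      rw [hb']
      simp only [conf, Mark.setAt, List.map_append, List.map_cons]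
      rw [modify_append_cons _ (by simp)]
      rfl
    simp only [hset]
    exact testTerm_conf eI eL eV hP r b₁ b₂ t (by simpa using hb)
      (fun z hz => hclean z (by simp [hz])) (fun z hz => hclean z (by simp [hz]))

end Loops

/-! ### The classes of terms -/

section Classes

variable {I L V : Type}

/-- Whether a constraint requires that two terms are equal. -/
def Pattern.Linked (P : Pattern I L V) (a b : PatTerm I L V) : Prop :=
  (a, b) ∈ P.pairs true ∨ (b, a) ∈ P.pairs true

theorem Pattern.Linked.symm {P : Pattern I L V} {a b : PatTerm I L V} (h : P.Linked a b) :
    P.Linked b a := Or.symm h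

theorem Pattern.meets_eq_true {P : Pattern I L V} {X S : PatTerm I L V → Bool} :
    P.meets X S = true ↔ ∃ a b, P.Linked a b ∧ X a = true ∧ S b = true := by
  simp only [Pattern.meets, Pattern.Linked, List.any_eq_true, Bool.or_eq_true, Bool.and_eq_true]
  constructor
  · rintro ⟨⟨a, b⟩, h, h' | h'⟩
    · exact ⟨a, b, .inl h, h'⟩
    · exact ⟨b, a, .inr h, h'.symm⟩
  · rintro ⟨a, b, h | h, h'⟩
    · exact ⟨(a, b), h, .inl h'⟩
    · exact ⟨(b, a), h, .inr h'.symm⟩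

@[simp] theorem ATok.single_atom (a c : PatTerm I L V) :
    (ATok.atom a).single c = true ↔ c = a := by simp [ATok.single]

theorem Pattern.meets_single {P : Pattern I L V} {a : PatTerm I L V} {S : PatTerm I L V → Bool} :
    P.meets (ATok.atom a).single S = true ↔ ∃ b, P.Linked a b ∧ S b = true := by
  simp [Pattern.meets_eq_true]

theorem Pattern.mem_atoks_of_mem_pairs {P : Pattern I L V} (e : Bool)
    {c : PatTerm I L V × PatTerm I L V} (h : c ∈ P.pairs e) :
    P.IsAF → .atom c.1 ∈ P.atoks ∧ .atom c.2 ∈ P.atoks := by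
  induction P with
  | triple | union | opt => simp [Pattern.pairs] at h
  | and P Q ihP ihQ =>
    intro hP
    simp only [Pattern.pairs, List.mem_append] at h
    rcases h with h | h
    · simp [Pattern.atoks, ihP h hP.1]
    · simp [Pattern.atoks, ihQ h hP.2]
  | filter P C ih =>
    intro hP
    simp only [Pattern.pairs, List.mem_append] at h
    rcases h with h | h
    · simp [Pattern.atoks, ih h hP]
    · cases C <;> cases e <;> simp [Constraint.pairs] at h <;> subst h <;>
        simp [Pattern.atoks, Constraint.atoks]

theorem Pattern.Linked.mem_atoks {P : Pattern I L V} (hP : P.IsAF) {a b : PatTerm I L V}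
    (h : P.Linked a b) : .atom a ∈ P.atoks := by
  rcases h with h | h
  · exact (P.mem_atoks_of_mem_pairs _ h hP).1
  · exact (P.mem_atoks_of_mem_pairs _ h hP).2

/-- Adding terms in one pass: the set does not shrink. -/
theorem growFold_mono (P : Pattern I L V) (l : List (ATok I L V)) (S : PatTerm I L V → Bool)
    {a : PatTerm I L V} (h : S a = true) :
    l.foldl (fun S t a => S a || (P.meets t.single S && t.single a)) S a = true := by
  induction l generalizing S with
  | nil => exact h
  | cons t l ih => exact ih _ (by simp [h])

theorem Pattern.growAll_mono (P : Pattern I L V) {S : PatTerm I L V → Bool} {a : PatTerm I L V}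
    (h : S a = true) : P.growAll S a = true :=
  growFold_mono P _ S h

theorem Pattern.growAll_of_linked {P : Pattern I L V} (hP : P.IsAF) {S : PatTerm I L V → Bool}
    {a b : PatTerm I L V} (h : P.Linked a b) (hb : S b = true) : P.growAll S a = true := by
  obtain ⟨l₁, l₂, hl⟩ := List.append_of_mem (h.mem_atoks hP)
  rw [Pattern.growAll, hl, List.foldl_append, List.foldl_cons]
  refine growFold_mono P l₂ _ ?_
  have hm : P.meets (ATok.atom a).single
      (l₁.foldl (fun S t a => S a || (P.meets t.single S && t.single a)) S) = true :=
    Pattern.meets_single.2 ⟨b, h, growFold_mono P l₁ S hb⟩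
  simp [hm]

/-- A property that is preserved by required equalities holds for the class of a term if it holds
for this term. -/
theorem Pattern.growAll_induction {P : Pattern I L V} {p : PatTerm I L V → Prop}
    (hp : ∀ a b, P.Linked a b → p b → p a) {S : PatTerm I L V → Bool}
    (hS : ∀ a, S a = true → p a) : ∀ a, P.growAll S a = true → p a := by
  unfold Pattern.growAll
  generalize P.atoks = l
  induction l generalizing S with
  | nil => exact hS
  | cons t l ih =>
    refine ih fun a ha => ?_
    simp only [Bool.or_eq_true, Bool.and_eq_true] at ha
    rcases ha with ha | ⟨hm, ha⟩
    · exact hS a ha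
    · cases t with
      | punct => simp [ATok.single] at ha
      | atom c =>
        rw [ATok.single_atom] at ha
        subst ha
        obtain ⟨b, hl, hb⟩ := Pattern.meets_single.1 hm
        exact hp a b hl (hS b hb)

theorem Pattern.iterate_growAll_induction {P : Pattern I L V} {p : PatTerm I L V → Prop}
    (hp : ∀ a b, P.Linked a b → p b → p a) {S : PatTerm I L V → Bool}
    (hS : ∀ a, S a = true → p a) (i : ℕ) : ∀ a, P.growAll^[i] S a = true → p a := by
  induction i generalizing S with
  | zero => exact hS
  | succ i ih => exact ih (Pattern.growAll_induction hp hS)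

/-- An inflationary operation on the subsets of a finite set reaches a fixed point after at most
as many steps as the set has elements. -/
theorem iterate_fixed_of_card {α : Type} (f : (α → Bool) → α → Bool) (T : Finset α)
    (hf : ∀ S a, S a = true → f S a = true) (S : α → Bool)
    (hT : ∀ i a, f^[i] S a = true → a ∈ T) : f (f^[T.card] S) = f^[T.card] S := by
  classical
  let c : ℕ → Finset α := fun i => T.filter fun a => f^[i] S a = true
  have hsub : ∀ i, c i ⊆ c (i + 1) := by
    intro i a ha
    simp only [c, Finset.mem_filter, Function.iterate_succ_apply'] at ha ⊢
    exact ⟨ha.1, hf _ _ ha.2⟩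
  have hmono : Monotone c := monotone_nat_of_le_succ hsub
  have hfix : ∀ i, c (i + 1) = c i → f (f^[i] S) = f^[i] S := by
    intro i h
    funext a
    rw [Bool.eq_iff_iff]
    refine ⟨fun ha => ?_, hf _ a⟩
    rw [← Function.iterate_succ_apply' f] at ha
    have : a ∈ c (i + 1) := Finset.mem_filter.2 ⟨hT _ a ha, ha⟩
    rw [h] at this
    exact (Finset.mem_filter.1 this).2
  by_contra hne
  have hstep : ∀ i ≤ T.card, c i ≠ c (i + 1) := by
    intro i hi h
    have h₁ := hfix i h.symm
    have h₂ : ∀ j, f^[i + j] S = f^[i] S := by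
      intro j
      induction j with
      | zero => rfl
      | succ j ih => rw [← Nat.add_assoc, Function.iterate_succ_apply', ih, h₁]
    apply hne
    obtain ⟨j, hj⟩ := Nat.exists_eq_add_of_le hi
    rw [hj, h₂, h₁]
  have hcard : ∀ i ≤ T.card + 1, i ≤ (c i).card := by
    intro i hi
    induction i with
    | zero => simp
    | succ i ih =>
      have := Finset.card_lt_card ((hsub i).ssubset_of_ne (hstep i (by lia)))
      have := ih (by lia)
      lia
  have h₁ := hcard _ le_rfl
  have h₂ : (c (T.card + 1)).card ≤ T.card := Finset.card_filter_le _ _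
  lia

/-- The marking procedure finds exactly the terms that are equal to the given term by a chain of
equality constraints: every round before the last new term is found adds a term, so that there are
at most as many such rounds as tokens. -/
theorem Pattern.classOf_atom {P : Pattern I L V} (hP : P.IsAF) {a : PatTerm I L V}
    (ha : .atom a ∈ P.atoks) (c : PatTerm I L V) :
    P.classOf (.atom a) c = true ↔ Relation.ReflTransGen P.Linked a c := by
  classical
  have hsound : ∀ i c, P.growAll^[i] (ATok.atom a).single c = true →
      Relation.ReflTransGen P.Linked a c := by
    refine fun i => Pattern.iterate_growAll_induction (fun x y hxy hy => hy.tail hxy.symm) ?_ i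
    intro x hx
    rw [ATok.single_atom] at hx
    rw [hx]
  refine ⟨hsound _ c, fun h => ?_⟩
  have hmem : ∀ c, Relation.ReflTransGen P.Linked a c → ATok.atom c ∈ P.atoks := by
    intro c h
    rcases h.cases_tail with rfl | ⟨b, _, hb⟩
    · exact ha
    · exact hb.symm.mem_atoks hP
  let T : Finset (PatTerm I L V) := (P.atoks.filterMap fun t =>
    match t with
    | .atom a => some a
    | .punct _ => none).toFinset
  have hTmem : ∀ c, ATok.atom c ∈ P.atoks → c ∈ T := by
    intro c hc
    simp only [T, List.mem_toFinset, List.mem_filterMap]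
    exact ⟨_, hc, rfl⟩
  have hTcard : T.card ≤ P.atoks.length :=
    (List.toFinset_card_le _).trans (List.length_filterMap_le _ _)
  have hfix := iterate_fixed_of_card P.growAll T (fun S a => P.growAll_mono) (ATok.atom a).single
    (fun i c hc => hTmem c (hmem c (hsound i c hc)))
  have hclass : P.classOf (.atom a) = P.growAll^[T.card] (ATok.atom a).single := by
    obtain ⟨j, hj⟩ := Nat.exists_eq_add_of_le hTcard
    rw [Pattern.classOf, hj, Nat.add_comm, Function.iterate_add_apply]
    exact Function.iterate_fixed hfix j
  rw [hclass]
  induction h with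
  | refl =>
    have : ∀ (i : ℕ) (S : PatTerm I L V → Bool), S a = true → P.growAll^[i] S a = true := by
      intro i
      induction i with
      | zero => exact fun _ h => h
      | succ i ih => exact fun S h => ih _ (P.growAll_mono h)
    exact this _ _ (by simp)
  | tail _ hbc ih =>
    rw [← hfix]
    exact Pattern.growAll_of_linked hP hbc.symm ih

end Classes

/-! ### Satisfiable patterns pass the tests -/

section Soundness

variable {I B L V : Type}

/-- What membership in the value of an AF-pattern says about a mapping, apart from the triples. -/
structure Pattern.Respects (P : Pattern I L V) (μ : Mapping I B L V) : Prop where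
  mem_dom : ∀ x, x ∈ μ.dom ↔ .var x ∈ P.tripleTerms
  eq : ∀ c ∈ P.pairs true, ∃ t, μ.app c.1 = some t ∧ μ.app c.2 = some t
  ne : ∀ c ∈ P.pairs false, ∃ s t, μ.app c.1 = some s ∧ μ.app c.2 = some t ∧ s ≠ t
  nonLit : ∀ a ∈ P.nonLits, ∃ t, μ.app a = some t ∧ ∀ l, t ≠ .lit l
  /-- What a filter requires of the domain is a property of the pattern alone. -/
  scope : ∀ x, P.scopeBad (fun a => (ATok.atom (.var x)).single a && a.sym = .var) = false

theorem Mapping.mem_dom_iff {μ : Mapping I B L V} {x : V} :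
    x ∈ μ.dom ↔ ∃ t, μ.toFun x = some t := by
  simp [Mapping.dom, Option.ne_none_iff_exists']

theorem Mapping.app_const (μ : Mapping I B L V) (c : Const I L) :
    μ.app (c.toPatTerm V) = some (c.toTerm B) := by
  cases c <;> rfl

theorem Mapping.app_union_left {μ ν : Mapping I B L V} {a : PatTerm I L V} {t : RDFTerm I B L}
    (h : μ.app a = some t) : (μ.union ν).app a = some t := by
  cases a with
  | var x => simp only [Mapping.app, Mapping.union] at h ⊢; simp [h]
  | _ => exact h

theorem Mapping.app_union_right {μ ν : Mapping I B L V} (hc : μ.Compatible ν)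
    {a : PatTerm I L V} {t : RDFTerm I B L} (h : ν.app a = some t) :
    (μ.union ν).app a = some t := by
  cases a with
  | var x =>
    simp only [Mapping.app, Mapping.union] at h ⊢
    cases hx : μ.toFun x with
    | none => simp [h]
    | some s =>
      have := hc x (Mapping.mem_dom_iff.2 ⟨s, hx⟩) (Mapping.mem_dom_iff.2 ⟨t, h⟩)
      rw [hx, h] at this
      simpa using this
  | _ => exact h

theorem Mapping.mem_dom_union {μ ν : Mapping I B L V} {x : V} :
    x ∈ (μ.union ν).dom ↔ x ∈ μ.dom ∨ x ∈ ν.dom := by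
  simp only [Mapping.dom, Mapping.union, Set.mem_ofPred_eq, ne_eq, Option.or_eq_none_iff]
  tauto

/-- The conditions are inherited from the two parts of a conjunction, because a term that has a
value under a part of a mapping has the same value under the whole mapping. -/
theorem Pattern.respects_of_mem_eval {G : RDFGraph I B L} {P : Pattern I L V} (hP : P.IsAF)
    {μ : Mapping I B L V} (h : μ ∈ P.eval G) : P.Respects μ := by
  induction P generalizing μ with
  | union | opt => exact hP.elim
  | triple u v w =>
    obtain ⟨hdom, a, b, c, ha, hb, -, hG⟩ := h
    have hrdf := G.isRDF _ hG
    refine ⟨fun x => ?_, by simp [Pattern.pairs], by simp [Pattern.pairs], ?_, fun x => rfl⟩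
    · rw [hdom]
      cases v <;> simp [tripleVars, Pattern.tripleTerms, PredTerm.toPatTerm, eq_comm]
    · intro d hd
      simp only [Pattern.nonLits, List.mem_cons, List.not_mem_nil, or_false] at hd
      rcases hd with rfl | rfl
      · refine ⟨a, ha, ?_⟩
        rintro l rfl
        simp [IsRDFTriple] at hrdf
      · refine ⟨b, hb, ?_⟩
        rintro l rfl
        simp [IsRDFTriple] at hrdf
  | and P Q ihP ihQ =>
    obtain ⟨μ₁, h₁, μ₂, h₂, hc, rfl⟩ := h
    have r₁ := ihP hP.1 h₁
    have r₂ := ihQ hP.2 h₂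
    refine ⟨fun x => ?_, fun c hc' => ?_, fun c hc' => ?_, fun a ha => ?_, fun x => ?_⟩
    · simp [Mapping.mem_dom_union, r₁.mem_dom, r₂.mem_dom, Pattern.tripleTerms]
    · rcases List.mem_append.1 hc' with h | h
      · obtain ⟨t, h, h'⟩ := r₁.eq c h
        exact ⟨t, Mapping.app_union_left h, Mapping.app_union_left h'⟩
      · obtain ⟨t, h, h'⟩ := r₂.eq c h
        exact ⟨t, Mapping.app_union_right hc h, Mapping.app_union_right hc h'⟩
    · rcases List.mem_append.1 hc' with h | h
      · obtain ⟨s, t, h, h', hne⟩ := r₁.ne c h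
        exact ⟨s, t, Mapping.app_union_left h, Mapping.app_union_left h', hne⟩
      · obtain ⟨s, t, h, h', hne⟩ := r₂.ne c h
        exact ⟨s, t, Mapping.app_union_right hc h, Mapping.app_union_right hc h', hne⟩
    · rcases List.mem_append.1 ha with h | h
      · obtain ⟨t, h, h'⟩ := r₁.nonLit a h
        exact ⟨t, Mapping.app_union_left h, h'⟩
      · obtain ⟨t, h, h'⟩ := r₂.nonLit a h
        exact ⟨t, Mapping.app_union_right hc h, h'⟩
    · simp [Pattern.scopeBad, r₁.scope, r₂.scope]
  | filter P C ih =>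
    obtain ⟨h, hs⟩ := h
    have r := ih hP h
    have hd : ∀ x, μ.app (.var x) = μ.toFun x := fun _ => rfl
    refine ⟨r.mem_dom, fun c hc => ?_, fun c hc => ?_, r.nonLit, fun x => ?_⟩
    · rcases List.mem_append.1 hc with h | h
      · exact r.eq c h
      · cases C <;> simp only [Constraint.pairs, if_true, List.mem_singleton, List.not_mem_nil] at h
        · subst h
          obtain ⟨hx, hy, hxy⟩ := hs
          obtain ⟨t, ht⟩ := Mapping.mem_dom_iff.1 hx
          exact ⟨t, ht, hxy.symm.trans ht⟩
        · subst h
          exact ⟨_, hs.2, Mapping.app_const _ _⟩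
    · rcases List.mem_append.1 hc with h | h
      · exact r.ne c h
      · cases C <;> simp only [Constraint.pairs, Bool.false_eq_true, if_false, List.mem_singleton,
          List.not_mem_nil] at h
        · subst h
          obtain ⟨hx, hy, hxy⟩ := hs
          obtain ⟨s, hs⟩ := Mapping.mem_dom_iff.1 hx
          obtain ⟨t, ht⟩ := Mapping.mem_dom_iff.1 hy
          exact ⟨s, t, hs, ht, fun h => hxy (by rw [hs, ht, h])⟩
        · subst h
          obtain ⟨hx, hxy⟩ := hs
          obtain ⟨s, hs⟩ := Mapping.mem_dom_iff.1 hx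
          exact ⟨s, _, hs, Mapping.app_const _ _, fun h => hxy (by rw [hs, h])⟩
    · have hany : (P.tripleTerms.any fun a =>
          (ATok.atom (.var x)).single a && decide (a.sym = .var)) = true ↔ x ∈ μ.dom := by
        simp only [List.any_eq_true, Bool.and_eq_true, ATok.single_atom, r.mem_dom]
        constructor
        · rintro ⟨a, ha, rfl, -⟩
          exact ha
        · exact fun h => ⟨_, h, rfl, rfl⟩
      have hpos : ∀ a ∈ C.posVars, ∃ y, a = .var y ∧ y ∈ μ.dom := by
        cases C <;> simp only [Constraint.posVars, List.mem_cons, List.not_mem_nil, or_false,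
          forall_eq_or_imp, forall_eq, false_imp_iff, implies_true, PatTerm.var.injEq,
          exists_eq_left'] <;> simp only [Mapping.Sat] at hs <;> tauto
      have hneg : ∀ a ∈ C.negVars, ∃ y, a = .var y ∧ y ∉ μ.dom := by
        cases C <;> simp only [Constraint.negVars, List.mem_cons, List.not_mem_nil, or_false,
          forall_eq, false_imp_iff, implies_true, PatTerm.var.injEq,
          exists_eq_left'] <;> simp only [Mapping.Sat] at hs <;> tauto
      rw [Pattern.scopeBad, r.scope x, Bool.false_or, Bool.or_eq_false_iff]
      by_cases hx : x ∈ μ.dom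
      · rw [hany.2 hx]
        simp only [Bool.not_true, Bool.and_false, Bool.and_true, true_and, List.any_eq_false,
          Bool.and_eq_true, ATok.single_atom]
        rintro a ha ⟨rfl, -⟩
        obtain ⟨y, hy, hy'⟩ := hneg _ ha
        cases hy
        exact hy' hx
      · have : (P.tripleTerms.any fun a =>
            (ATok.atom (.var x)).single a && decide (a.sym = .var)) = false := by
          rw [← Bool.not_eq_true, hany]
          exact hx
        rw [this]
        simp only [Bool.not_false, Bool.and_false, Bool.and_true, and_true, List.any_eq_false,
          Bool.and_eq_true, ATok.single_atom]
        rintro a ha ⟨rfl, -⟩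
        obtain ⟨y, hy, hy'⟩ := hpos _ ha
        cases hy
        exact hx hy'

theorem PatTerm.isConst_sym {a : PatTerm I L V} :
    a.sym.isConst = true ↔ ∃ c : Const I L, a = c.toPatTerm V := by
  constructor
  · intro h
    cases a with
    | iri i => exact ⟨.iri i, rfl⟩
    | lit l => exact ⟨.lit l, rfl⟩
    | var x => simp [PatTerm.sym, Sym.isConst] at h
  · rintro ⟨c, rfl⟩
    cases c <;> simp [Const.toPatTerm, PatTerm.sym, Sym.isConst, Sym.isAtom]

theorem Const.toTerm_injective : Function.Injective (Const.toTerm B : Const I L → _) := by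
  intro c d h
  cases c <;> cases d <;> simp_all [Const.toTerm]

/-- The conditions on the class of a term at a token, as a disjunction. -/
theorem Pattern.classBad_atom {P : Pattern I L V} {a : PatTerm I L V}
    {S : PatTerm I L V → Bool} :
    P.classBad (ATok.atom a).single S = true ↔
      (∃ c ∈ P.pairs false, S c.1 = true ∧ S c.2 = true) ∨
      (∃ l, .atom (.lit l) ∈ P.atoks ∧ S (.lit l) = true ∧ ∃ b ∈ P.nonLits, S b = true) ∨
      (.atom a ∈ P.atoks ∧ (∃ c : Const I L, a = c.toPatTerm V) ∧ ∃ d : Const I L,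
        .atom (d.toPatTerm V) ∈ P.atoks ∧ S (d.toPatTerm V) = true ∧ d.toPatTerm V ≠ a) := by
  have hlit : (P.atoks.any fun t => t.sat S && t.sym = .lit) = true ↔
      ∃ l, .atom (.lit l) ∈ P.atoks ∧ S (.lit l) = true := by
    simp only [List.any_eq_true, Bool.and_eq_true, decide_eq_true_eq]
    constructor
    · rintro ⟨t, ht, h, h'⟩
      cases t with
      | punct => simp at h
      | atom b =>
        cases b with
        | lit l => exact ⟨l, ht, h⟩
        | _ => simp [PatTerm.sym] at h'
    · rintro ⟨l, hl, h⟩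
      exact ⟨_, hl, h, rfl⟩
  have hN : (P.atoks.any fun t => t.sat (ATok.atom a).single && t.sym.isConst) = true ↔
      .atom a ∈ P.atoks ∧ ∃ c : Const I L, a = c.toPatTerm V := by
    simp only [List.any_eq_true, Bool.and_eq_true]
    constructor
    · rintro ⟨t, ht, h, h'⟩
      cases t with
      | punct => simp at h
      | atom b =>
        simp only [ATok.sat_atom, ATok.single_atom, ATok.sym_atom, PatTerm.isConst_sym] at h h'
        subst h
        exact ⟨ht, h'⟩
    · rintro ⟨h, h'⟩
      exact ⟨_, h, by simp, PatTerm.isConst_sym.2 h'⟩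
  have hS : (P.atoks.any fun t => t.sat S && !t.sat (ATok.atom a).single && t.sym.isConst) = true ↔
      ∃ d : Const I L, .atom (d.toPatTerm V) ∈ P.atoks ∧ S (d.toPatTerm V) = true ∧
        d.toPatTerm V ≠ a := by
    simp only [List.any_eq_true, Bool.and_eq_true, Bool.not_eq_true']
    constructor
    · rintro ⟨t, ht, ⟨h, hn⟩, h'⟩
      cases t with
      | punct => simp at h
      | atom b =>
        simp only [ATok.sat_atom, ATok.sym_atom, PatTerm.isConst_sym] at h h' hn
        obtain ⟨d, rfl⟩ := h'
        exact ⟨d, ht, h, fun h => by simp [← h, ATok.single] at hn⟩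
    · rintro ⟨d, hd, h, hn⟩
      exact ⟨_, hd, ⟨h, by simpa [ATok.single] using hn⟩, PatTerm.isConst_sym.2 ⟨d, rfl⟩⟩
  simp only [Pattern.classBad, Bool.or_eq_true, Bool.and_eq_true, hlit, hN, hS]
  simp only [List.any_eq_true, Bool.and_eq_true]
  constructor
  · rintro ((h | ⟨⟨l, h₁, h₂⟩, h₃⟩) | ⟨⟨h₁, h₂⟩, h₃⟩)
    exacts [.inl h, .inr (.inl ⟨l, h₁, h₂, h₃⟩), .inr (.inr ⟨h₁, h₂, h₃⟩)]
  · rintro (h | ⟨l, h₁, h₂, h₃⟩ | ⟨h₁, h₂, h₃⟩)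
    exacts [.inl (.inl h), .inl (.inr ⟨⟨l, h₁, h₂⟩, h₃⟩), .inr ⟨⟨h₁, h₂⟩, h₃⟩]

theorem Pattern.Respects.app_eq_of_linked {P : Pattern I L V} {μ : Mapping I B L V}
    (h : P.Respects μ) {a b : PatTerm I L V} (hab : Relation.ReflTransGen P.Linked a b) :
    μ.app a = μ.app b := by
  induction hab with
  | refl => rfl
  | tail _ hbc ih =>
    rw [ih]
    rcases hbc with hbc | hbc
    · obtain ⟨t, h₁, h₂⟩ := h.eq _ hbc
      exact h₁.trans h₂.symm
    · obtain ⟨t, h₁, h₂⟩ := h.eq _ hbc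
      exact h₂.trans h₁.symm

/-- All terms in a class have the same value under a solution, so that no test can fail. -/
theorem Pattern.Respects.termBad_eq_false {P : Pattern I L V} (hP : P.IsAF)
    {μ : Mapping I B L V} (h : P.Respects μ) {t : ATok I L V} (ht : t ∈ P.atoks) :
    P.termBad t = false := by
  have hscope : ∀ Q : Pattern I L V, Q.scopeBad (fun _ => false) = false := by
    intro Q
    induction Q <;> simp_all [Pattern.scopeBad]
  cases t with
  | punct s =>
    have hclass : ∀ a, P.classOf (.punct s) a = false := by
      intro a
      rw [← Bool.not_eq_true]
      exact Pattern.iterate_growAll_induction (p := fun _ => False) (fun _ _ _ => id)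
        (by simp [ATok.single]) _ a
    have hsat : ∀ u : ATok I L V, u.sat (P.classOf (.punct s)) = false ∧
        u.sat (ATok.punct s).single = false := by
      rintro (_ | a)
      · exact ⟨rfl, rfl⟩
      · exact ⟨hclass a, rfl⟩
    simp only [Pattern.termBad, Pattern.classBad, hclass, hsat, ATok.single, Bool.false_and, hscope]
    simp
  | atom a =>
    rw [Pattern.termBad, Bool.or_eq_false_iff]
    constructor
    · cases a with
      | var x => exact h.scope x
      | _ =>
        rw [← hscope P]
        congr 1
        funext b
        rw [Bool.and_eq_false_iff, decide_eq_false_iff_not, ← Bool.not_eq_true, ATok.single_atom]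
        by_contra! hb
        rw [hb.1] at hb
        simp [PatTerm.sym] at hb
    · rw [← Bool.not_eq_true, Pattern.classBad_atom]
      simp only [Pattern.classOf_atom hP ht]
      rintro (⟨c, hc, h₁, h₂⟩ | ⟨l, -, h₁, b, hb, h₂⟩ | ⟨-, ⟨c, rfl⟩, d, -, h₁, h₂⟩)
      · obtain ⟨s, t, hs, ht, hne⟩ := h.ne c hc
        rw [← h.app_eq_of_linked h₁, h.app_eq_of_linked h₂, ht] at hs
        exact hne (Option.some.inj hs).symm
      · obtain ⟨t, ht, hne⟩ := h.nonLit b hb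
        rw [← h.app_eq_of_linked h₂, h.app_eq_of_linked h₁] at ht
        exact hne l (Option.some.inj ht).symm
      · have := h.app_eq_of_linked h₁
        rw [Mapping.app_const, Mapping.app_const, Option.some.injEq] at this
        rw [Const.toTerm_injective this] at h₂
        exact h₂ rfl

end Soundness

/-! ### A canonical solution of the patterns that pass the tests -/

section Completeness

variable {I B L V : Type}

/-- The images of the triple patterns of a pattern under a function on terms. -/
def Pattern.image (f : PatTerm I L V → RDFTerm I B L) :
    Pattern I L V → List (RDFTerm I B L × RDFTerm I B L × RDFTerm I B L)
  | .triple u v w => [(f u, f (v.toPatTerm L), f w)]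
  | .and P Q => P.image f ++ Q.image f
  | .filter P _ => P.image f
  | _ => []

open Classical in
/-- The restriction of a function on terms to the variables in the triple patterns of a pattern. -/
noncomputable def Pattern.solution (f : PatTerm I L V → RDFTerm I B L) (P : Pattern I L V) :
    Mapping I B L V where
  toFun x := if .var x ∈ P.tripleTerms then some (f (.var x)) else none
  finite_dom := (P.tripleTerms.finite_toSet.preimage
    (f := PatTerm.var) (fun _ _ _ _ h => PatTerm.var.inj h)).subset fun x hx => by
      by_contra h
      exact hx (if_neg h)

theorem Pattern.mem_dom_solution {f : PatTerm I L V → RDFTerm I B L} {P : Pattern I L V} {x : V} :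
    x ∈ (P.solution f).dom ↔ .var x ∈ P.tripleTerms := by
  simp [Mapping.dom, Pattern.solution]

theorem Pattern.solution_var {f : PatTerm I L V → RDFTerm I B L} {P : Pattern I L V} {x : V}
    (h : .var x ∈ P.tripleTerms) : (P.solution f).toFun x = some (f (.var x)) :=
  if_pos h

theorem Pattern.mem_atoks_of_mem_tripleTerms {P : Pattern I L V} {a : PatTerm I L V}
    (h : a ∈ P.tripleTerms) : .atom a ∈ P.atoks := by
  induction P with
  | union | opt => simp [Pattern.tripleTerms] at h
  | triple u v w =>
    simp only [Pattern.tripleTerms, List.mem_cons, List.not_mem_nil, or_false] at h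
    rcases h with rfl | rfl | rfl <;> simp [Pattern.atoks]
  | and P Q ihP ihQ =>
    rcases List.mem_append.1 h with h | h
    · simp [Pattern.atoks, ihP h]
    · simp [Pattern.atoks, ihQ h]
  | filter P C ih => simp [Pattern.atoks, ih h]

theorem Pattern.nonLits_subset_tripleTerms {P : Pattern I L V} {a : PatTerm I L V}
    (h : a ∈ P.nonLits) : a ∈ P.tripleTerms := by
  induction P with
  | union | opt => exact h
  | triple u v w =>
    simp only [Pattern.nonLits, List.mem_cons, List.not_mem_nil, or_false] at h
    rcases h with rfl | rfl <;> simp [Pattern.tripleTerms]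
  | and P Q ihP ihQ =>
    rcases List.mem_append.1 h with h | h
    · simp [Pattern.tripleTerms, ihP h]
    · simp [Pattern.tripleTerms, ihQ h]
  | filter P C ih => exact ih h

theorem Pattern.exists_of_mem_image {f : PatTerm I L V → RDFTerm I B L} {P : Pattern I L V}
    {t : RDFTerm I B L × RDFTerm I B L × RDFTerm I B L} (h : t ∈ P.image f) :
    ∃ u v w, t = (f u, f v, f w) ∧ u ∈ P.nonLits ∧ v ∈ P.nonLits := by
  induction P with
  | union | opt => simp [Pattern.image] at h
  | triple u v w =>
    simp only [Pattern.image, List.mem_singleton] at h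
    exact ⟨u, v.toPatTerm L, w, h, by simp [Pattern.nonLits], by simp [Pattern.nonLits]⟩
  | and P Q ihP ihQ =>
    rcases List.mem_append.1 h with h | h
    · obtain ⟨u, v, w, ht, hu, hv⟩ := ihP h
      exact ⟨u, v, w, ht, by simp [Pattern.nonLits, hu], by simp [Pattern.nonLits, hv]⟩
    · obtain ⟨u, v, w, ht, hu, hv⟩ := ihQ h
      exact ⟨u, v, w, ht, by simp [Pattern.nonLits, hu], by simp [Pattern.nonLits, hv]⟩
  | filter P C ih => exact ih h

/-- If a function on terms is the identity on constants and satisfies the equality and inequality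
constraints, and the other constraints are satisfied with respect to the scopes, then the function
gives a solution in every graph that contains the images of all triple patterns. -/
theorem Pattern.solution_mem_eval (f : PatTerm I L V → RDFTerm I B L) (G : RDFGraph I B L)
    {P : Pattern I L V} (hP : P.IsAF) (hG : ∀ t ∈ P.image f, t ∈ G.triples)
    (hconst : ∀ c : Const I L, .atom (c.toPatTerm V) ∈ P.atoks → f (c.toPatTerm V) = c.toTerm B)
    (heq : ∀ c ∈ P.pairs true, f c.1 = f c.2) (hne : ∀ c ∈ P.pairs false, f c.1 ≠ f c.2)
    (hscope : ∀ x, .atom (.var x) ∈ P.atoks →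
      P.scopeBad (fun a => (ATok.atom (.var x)).single a && a.sym = .var) = false) :
    P.solution f ∈ P.eval G := by
  induction P with
  | union | opt => exact hP.elim
  | triple u v w =>
    have happ : ∀ a ∈ (Pattern.triple u v w).tripleTerms,
        ((Pattern.triple u v w).solution f).app a = some (f a) := by
      intro a ha
      have ha' := Pattern.mem_atoks_of_mem_tripleTerms ha
      cases a with
      | iri i => exact congrArg some (hconst (.iri i) ha').symm
      | lit l => exact congrArg some (hconst (.lit l) ha').symm
      | var x => exact Pattern.solution_var ha
    refine ⟨?_, _, _, _, happ u (by simp [Pattern.tripleTerms]),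
      happ (v.toPatTerm L) (by simp [Pattern.tripleTerms]),
      happ w (by simp [Pattern.tripleTerms]), hG _ (by simp [Pattern.image])⟩
    ext x
    rw [Pattern.mem_dom_solution]
    cases v <;> simp [tripleVars, Pattern.tripleTerms, PredTerm.toPatTerm, eq_comm]
  | and P Q ihP ihQ =>
    have hP' := ihP hP.1 (fun t ht => hG t (List.mem_append_left _ ht))
      (fun c hc => hconst c (by simp [Pattern.atoks, hc]))
      (fun c hc => heq c (List.mem_append_left _ hc))
      (fun c hc => hne c (List.mem_append_left _ hc))
      (fun x hx => (Bool.or_eq_false_iff.1 (hscope x (by simp [Pattern.atoks, hx]))).1)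
    have hQ' := ihQ hP.2 (fun t ht => hG t (List.mem_append_right _ ht))
      (fun c hc => hconst c (by simp [Pattern.atoks, hc]))
      (fun c hc => heq c (List.mem_append_right _ hc))
      (fun c hc => hne c (List.mem_append_right _ hc))
      (fun x hx => (Bool.or_eq_false_iff.1 (hscope x (by simp [Pattern.atoks, hx]))).2)
    refine ⟨_, hP', _, hQ', fun x hx hx' => ?_, ?_⟩
    · rw [Pattern.solution_var (Pattern.mem_dom_solution.1 hx),
        Pattern.solution_var (Pattern.mem_dom_solution.1 hx')]
    · have : ((P.and Q).solution f).toFun = ((P.solution f).union (Q.solution f)).toFun := by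
        funext x
        simp only [Pattern.solution, Mapping.union, Pattern.tripleTerms, List.mem_append]
        by_cases h : .var x ∈ P.tripleTerms <;> by_cases h' : .var x ∈ Q.tripleTerms <;>
          simp [h, h']
      generalize hμ : (P.and Q).solution f = μ at *
      generalize hν : (P.solution f).union (Q.solution f) = ν at *
      cases μ
      cases ν
      cases this
      rfl
  | filter P C ih =>
    have h := ih hP hG (fun c hc => hconst c (by simp [Pattern.atoks, hc]))
      (fun c hc => heq c (List.mem_append_left _ hc))
      (fun c hc => hne c (List.mem_append_left _ hc)) (fun x hx => by
        have := hscope x (by simp [Pattern.atoks, hx])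
        simp only [Pattern.scopeBad, Bool.or_eq_false_iff] at this
        exact this.1.1)
    have hany : ∀ x, (P.tripleTerms.any fun a =>
        (ATok.atom (.var x)).single a && decide (a.sym = .var)) = true ↔
          .var x ∈ P.tripleTerms := by
      intro x
      simp only [List.any_eq_true, Bool.and_eq_true, ATok.single_atom]
      constructor
      · rintro ⟨a, ha, rfl, -⟩
        exact ha
      · exact fun h => ⟨_, h, rfl, rfl⟩
    have hpos : ∀ x, .var x ∈ C.posVars → .var x ∈ P.tripleTerms := by
      intro x hx
      have hmem : .atom (.var x) ∈ (P.filter C).atoks := by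
        cases C <;> simp_all [Constraint.posVars, Pattern.atoks, Constraint.atoks]
      have h₁ := hscope x hmem
      simp only [Pattern.scopeBad, Bool.or_eq_false_iff] at h₁
      have h₂ : (C.posVars.any fun a =>
          (ATok.atom (.var x)).single a && decide (a.sym = .var)) = true :=
        List.any_eq_true.2 ⟨_, hx, by simp [PatTerm.sym]⟩
      rw [← hany]
      simpa [h₂] using h₁.1.2
    have hneg : ∀ x, .var x ∈ C.negVars → .var x ∉ P.tripleTerms := by
      intro x hx hx'
      have hmem : .atom (.var x) ∈ (P.filter C).atoks := by
        cases C <;> simp_all [Constraint.negVars, Pattern.atoks, Constraint.atoks]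
      have h₁ := hscope x hmem
      simp only [Pattern.scopeBad, Bool.or_eq_false_iff] at h₁
      have h₂ : (C.negVars.any fun a =>
          (ATok.atom (.var x)).single a && decide (a.sym = .var)) = true :=
        List.any_eq_true.2 ⟨_, hx, by simp [PatTerm.sym]⟩
      have h₃ := h₁.2
      rw [h₂, (hany x).2 hx'] at h₃
      simp at h₃
    refine ⟨h, ?_⟩
    have hdom : ∀ x, x ∈ ((P.filter C).solution f).dom ↔ .var x ∈ P.tripleTerms :=
      fun x => Pattern.mem_dom_solution
    have hval : ∀ x, .var x ∈ P.tripleTerms →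
        ((P.filter C).solution f).toFun x = some (f (.var x)) :=
      fun x hx => Pattern.solution_var hx
    have hc : ∀ c : Const I L, .atom (c.toPatTerm V) ∈ C.atoks →
        f (c.toPatTerm V) = c.toTerm B :=
      fun c hc => hconst c (by simp [Pattern.atoks, hc])
    have heq' : ∀ c ∈ C.pairs true, f c.1 = f c.2 := fun c hc => heq c (List.mem_append_right _ hc)
    have hne' : ∀ c ∈ C.pairs false, f c.1 ≠ f c.2 := fun c hc => hne c (List.mem_append_right _ hc)
    cases C with
    | bound x => exact (hdom x).2 (hpos x (by simp [Constraint.posVars]))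
    | notBound x => exact fun h => hneg x (by simp [Constraint.negVars]) ((hdom x).1 h)
    | eq x y =>
      have hx := hpos x (by simp [Constraint.posVars])
      have hy := hpos y (by simp [Constraint.posVars])
      refine ⟨(hdom x).2 hx, (hdom y).2 hy, ?_⟩
      rw [hval x hx, hval y hy, heq' (.var x, .var y) (by simp [Constraint.pairs])]
    | neq x y hxy =>
      have hx := hpos x (by simp [Constraint.posVars])
      have hy := hpos y (by simp [Constraint.posVars])
      refine ⟨(hdom x).2 hx, (hdom y).2 hy, ?_⟩
      rw [hval x hx, hval y hy, ne_eq, Option.some.injEq]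
      exact hne' (.var x, .var y) (by simp [Constraint.pairs])
    | eqConst x c =>
      have hx := hpos x (by simp [Constraint.posVars])
      refine ⟨(hdom x).2 hx, ?_⟩
      rw [hval x hx, heq' (.var x, c.toPatTerm V) (by simp [Constraint.pairs]),
        hc c (by simp [Constraint.atoks])]
    | neqConst x c =>
      have hx := hpos x (by simp [Constraint.posVars])
      refine ⟨(hdom x).2 hx, ?_⟩
      rw [hval x hx, ← hc c (by simp [Constraint.atoks]), ne_eq, Option.some.injEq]
      exact hne' (.var x, c.toPatTerm V) (by simp [Constraint.pairs])

theorem Pattern.linked_equivalence (P : Pattern I L V) :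
    Equivalence (Relation.ReflTransGen P.Linked) :=
  have : Std.Symm P.Linked := ⟨fun _ _ => Pattern.Linked.symm⟩
  ⟨fun _ => .refl, fun h => Relation.ReflTransGen.stdSymm.symm _ _ h, .trans⟩

open Classical in
/-- The value assigned to a class of terms: the constant in the class, if there is one, and
otherwise an IRI of its own, which is given by the first token that belongs to the class. -/
noncomputable def Pattern.value (B : Type) (P : Pattern I L V) (g : ℕ → I)
    (S : PatTerm I L V → Prop) : RDFTerm I B L :=
  if h : ∃ c : Const I L, S (c.toPatTerm V) then h.choose.toTerm B
  else .iri (g (sInf {k | ∃ a, P.atoks[k]? = some (.atom a) ∧ S a}))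

/-- The values of the classes of terms give a solution: distinct classes have distinct values, as
the IRIs chosen for classes without constants do not occur in the pattern. -/
theorem Pattern.satisfiable_of_termBad_eq_false [Infinite I] {P : Pattern I L V} (hP : P.IsAF)
    (h : ∀ t ∈ P.atoks, P.termBad t = false) : P.Satisfiable B := by
  classical
  have equiv := P.linked_equivalence
  -- names for the values of the classes without constants, distinct from the IRIs in the pattern
  have hfin : {i : I | ATok.atom (PatTerm.iri i : PatTerm I L V) ∈ P.atoks}.Finite :=
    (P.atoks.finite_toSet.preimage (f := fun i : I => ATok.atom (PatTerm.iri i : PatTerm I L V))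
      (fun _ _ _ _ h => by simpa using h))
  have : Infinite ({i : I | ATok.atom (PatTerm.iri i : PatTerm I L V) ∈ P.atoks}ᶜ : Set I) :=
    hfin.infinite_compl.to_subtype
  let e := Infinite.natEmbedding
    ({i : I | ATok.atom (PatTerm.iri i : PatTerm I L V) ∈ P.atoks}ᶜ : Set I)
  let g : ℕ → I := fun k => e k
  have hg : Function.Injective g := Subtype.val_injective.comp e.injective
  have hfresh : ∀ k, ATok.atom (PatTerm.iri (g k) : PatTerm I L V) ∉ P.atoks := fun k => (e k).2
  let f : PatTerm I L V → RDFTerm I B L := fun a => P.value B g (Relation.ReflTransGen P.Linked a)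
  have hclassBad : ∀ a, .atom a ∈ P.atoks →
      ¬ P.classBad (ATok.atom a).single (P.classOf (.atom a)) = true := by
    intro a ha
    have := h _ ha
    simp only [Pattern.termBad, Bool.or_eq_false_iff] at this
    simp [this.2]
  simp only [Pattern.classBad_atom, not_or] at hclassBad
  have hmem : ∀ {a b}, .atom a ∈ P.atoks → Relation.ReflTransGen P.Linked a b →
      .atom b ∈ P.atoks := by
    intro a b ha hab
    rcases hab.cases_tail with rfl | ⟨c, _, hc⟩
    · exact ha
    · exact hc.symm.mem_atoks hP
  have hcongr : ∀ {a b}, Relation.ReflTransGen P.Linked a b → f a = f b := by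
    intro a b hab
    have : Relation.ReflTransGen P.Linked a = Relation.ReflTransGen P.Linked b := by
      funext c
      exact propext ⟨fun h => equiv.trans (equiv.symm hab) h, fun h => equiv.trans hab h⟩
    simp only [f, this]
  -- the two forms of the values
  have hcases : ∀ a, (∃ c : Const I L, Relation.ReflTransGen P.Linked a (c.toPatTerm V) ∧
      f a = c.toTerm B) ∨
      f a = .iri (g (sInf {k | ∃ b, P.atoks[k]? = some (.atom b) ∧
        Relation.ReflTransGen P.Linked a b})) := by
    intro a
    by_cases hc : ∃ c : Const I L, Relation.ReflTransGen P.Linked a (c.toPatTerm V)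
    · exact .inl ⟨hc.choose, hc.choose_spec, by simp only [f, Pattern.value, dif_pos hc]⟩
    · exact .inr (by simp only [f, Pattern.value, dif_neg hc])
  have hconst : ∀ c : Const I L, .atom (c.toPatTerm V) ∈ P.atoks →
      f (c.toPatTerm V) = c.toTerm B := by
    intro c hc
    have hex : ∃ d : Const I L,
        Relation.ReflTransGen P.Linked (c.toPatTerm V) (d.toPatTerm V) := ⟨c, .refl⟩
    have hd := hex.choose_spec
    have hf : f (c.toPatTerm V) = hex.choose.toTerm B := by
      simp only [f, Pattern.value, dif_pos hex]
    by_cases hcd : hex.choose.toPatTerm V = c.toPatTerm V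
    · rw [hf, ← Option.some.injEq, ← Mapping.app_const (V := V) ⟨fun _ => none, by simp⟩,
        ← Mapping.app_const (V := V) ⟨fun _ => none, by simp⟩, hcd]
    · exact absurd ⟨hc, ⟨c, rfl⟩, hex.choose, hmem hc hd, (Pattern.classOf_atom hP hc _).2 hd, hcd⟩
        (hclassBad _ hc).2.2
  have hinj : ∀ {a b}, .atom a ∈ P.atoks → .atom b ∈ P.atoks → f a = f b →
      Relation.ReflTransGen P.Linked a b := by
    have hnot : ∀ {a}, .atom a ∈ P.atoks → ∀ (c : Const I L) k,
        Relation.ReflTransGen P.Linked a (c.toPatTerm V) → c.toTerm B ≠ .iri (g k) := by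
      intro a ha c k hac hck
      cases c with
      | lit l => simp [Const.toTerm] at hck
      | iri i =>
        simp only [Const.toTerm, RDFTerm.iri.injEq] at hck
        subst hck
        exact hfresh k (hmem ha hac)
    intro a b ha hb hab
    rcases hcases a with ⟨c, hc, hfa⟩ | hfa <;> rcases hcases b with ⟨d, hd, hfb⟩ | hfb
    · rw [hfa, hfb] at hab
      rw [Const.toTerm_injective hab] at hc
      exact equiv.trans hc (equiv.symm hd)
    · exact absurd (hfa.symm.trans (hab.trans hfb)) (hnot ha c _ hc)
    · exact absurd (hfb.symm.trans (hab.symm.trans hfa)) (hnot hb d _ hd)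
    · have hidx : ∀ {a}, .atom a ∈ P.atoks → ({k | ∃ b, P.atoks[k]? = some (.atom b) ∧
          Relation.ReflTransGen P.Linked a b} : Set ℕ).Nonempty := by
        intro a ha
        obtain ⟨k, hk⟩ := List.getElem?_of_mem ha
        exact ⟨k, a, hk, .refl⟩
      rw [hfa, hfb, RDFTerm.iri.injEq] at hab
      obtain ⟨c, hc, hac⟩ := Nat.sInf_mem (hidx ha)
      obtain ⟨d, hd, hbd⟩ := Nat.sInf_mem (hidx hb)
      rw [hg hab, hd, Option.some.injEq, ATok.atom.injEq] at hc
      subst hc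
      exact equiv.trans hac (equiv.symm hbd)
  have hnonLit : ∀ a ∈ P.nonLits, ∃ i, f a = .iri i := by
    intro a ha
    have ha' := Pattern.mem_atoks_of_mem_tripleTerms (Pattern.nonLits_subset_tripleTerms ha)
    rcases hcases a with ⟨c, hc, hfa⟩ | hfa
    · cases c with
      | iri i => exact ⟨i, hfa⟩
      | lit l =>
        exact absurd ⟨l, hmem ha' hc, (Pattern.classOf_atom hP ha' _).2 hc, a, ha,
          (Pattern.classOf_atom hP ha' _).2 .refl⟩ (hclassBad a ha').2.1
    · exact ⟨_, hfa⟩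
  let G : RDFGraph I B L :=
    { triples := (P.image f).toFinset
      isRDF := by
        intro t ht
        obtain ⟨u, v, w, rfl, hu, hv⟩ := Pattern.exists_of_mem_image (List.mem_toFinset.1 ht)
        exact ⟨.inl (hnonLit u hu), hnonLit v hv⟩ }
  refine ⟨G, P.solution f, Pattern.solution_mem_eval f G hP (fun t ht => List.mem_toFinset.2 ht)
    hconst ?_ ?_ ?_⟩
  · exact fun c hc => hcongr (.single (.inl hc))
  · intro c hc hf
    obtain ⟨h₁, h₂⟩ := P.mem_atoks_of_mem_pairs _ hc hP
    exact (hclassBad c.1 h₁).1 ⟨c, hc, (Pattern.classOf_atom hP h₁ _).2 .refl,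
      (Pattern.classOf_atom hP h₁ _).2 (hinj h₁ h₂ hf)⟩
  · intro x hx
    have := h _ hx
    simp only [Pattern.termBad, Bool.or_eq_false_iff] at this
    exact this.1

/-- An AF-pattern is satisfiable if and only if all its terms pass the tests. -/
theorem Pattern.satisfiable_iff [Infinite I] {P : Pattern I L V} (hP : P.IsAF) :
    P.Satisfiable B ↔ P.atoks.any P.termBad = false := by
  rw [List.any_eq_false]
  constructor
  · rintro ⟨G, μ, hμ⟩ t ht
    simp [(Pattern.respects_of_mem_eval hP hμ).termBad_eq_false hP ht]
  · exact fun h => Pattern.satisfiable_of_termBad_eq_false hP fun t ht => by simpa using h t ht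

end Completeness

end SPARQL

theorem mainTheorem7 (I B L V : Type) [Infinite I] [Infinite B] [Infinite L] [Infinite V]
    (eI : Computability.Encoding I Bool) (eL : Computability.Encoding L Bool)
    (eV : Computability.Encoding V Bool) :
    SPARQL.CheckableInPolyTime (SPARQL.afEncoding eI eL eV)
      (fun P : SPARQL.AFPattern I L V => P.1.Satisfiable B) := by
  refine SPARQL.polyTime_testPattern.checkable (SPARQL.afEncoding eI eL eV) _
    (fun s => ({ sym := s } : SPARQL.Head)) {}
    (fun P => P.1.atoks.map fun t => ({ sym := t.sym }, t.name eI eL eV))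
    (fun P => SPARQL.flat_map_atoks eI eL eV (fun s => ({ sym := s } : SPARQL.Head)) P.2)
    (fun v => !v.rej) fun P => ?_
  rw [SPARQL.testPattern_conf eI eL eV P.2, SPARQL.Pattern.satisfiable_iff P.2,
    Bool.not_eq_true']
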